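/- Let $g$ be an integer with $3\le g\le 12$ and put $k=\lfloor g/2\rfloor$. For complex parameters $a=(a_{i,j})$, $1\le i\le g-1$, $j=1,2$, such that for each $j$ the numbers $a_{1,j},\dots,a_{g-1,j}$ are distinct and nonzero, let $C=C_1\cup C_2$ be the binary curve of genus $g$ obtained from two copies $C_1,C_2$ of $\mathbb P^1_{\mathbb C}$ by gluing, to ordinary nodes $P_1,\dots,P_{g+1}$, the point $a_{i,1}\in C_1$ to $a_{i,2}\in C_2$ (node $P_i$, $1\le i\le g-1$), $0$ to $0$ (node $P_g$), and $\infty$ to $\infty$ (node $P_{g+1}$). Let $A$ be the nontrivial line bundle on $C$ with $A^{\otimes 2}\cong\mathcal O_C$ that is trivial on both components and corresponds to the class of $(h_1,\dots,h_{g+1})$ in $\mathrm{Pic}^0(C)\cong(\mathbb C^*)^{g+1}/\mathbb C^*$, where $h_i=1$ for $i\le k$, $h_i=-1$ for $k<i\le g-1$, $h_g=-1$, $h_{g+1}=1$. Such a pair $[C,\omega_C\otimes A]$ is called a Prym-canonical binary curve of genus $g$. Its first Gaussian map $$\mu_A:\Lambda^2H^0(C,\omega_C\otimes A)\longrightarrow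 H^0\big(C,(\omega_C\otimes A)^{\otimes 2}\otimes\Omega^1_C\big)\cong H^0(C,\omega_C^{\otimes 2}\otimes\Omega^1_C)$$ is the linear map given locally by $$\mu_A(\sigma_1\wedge\sigma_2)=(f_1\,df_2-f_2\,df_1)\,\xi^2\otimes l^2\quad\text{for }\sigma_i=f_i\,\xi\otimes l,$$ where $\xi$ and $l$ are local generators of the dualizing sheaf $\omega_C$ and of $A$, and $\Omega^1_C$ is the sheaf of Kähler differentials (which has torsion at the nodes). Then for a general Prym-canonical binary curve of genus $g$ the map $\mu_A$ is injective. That is, there is a nonzero polynomial $F$ in the $2(g-1)$ variables $a_{i,j}$ such that every $a\in\mathbb C^{2(g-1)}$ with $F(a)\ne0$ has, for each $j$, distinct and nonzero $a_{1,j},\dots,a_{g-1,j}$, and the map $\mu_A$ of the corresponding pair is injective. -/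

import Mathlib

open scoped KaehlerDifferential

noncomputable section

namespace PrymBinary

/-! ### The projective line over `ℂ` through its function field -/

/-- The function field `ℂ(t)` of the projective line. -/
abbrev K : Type := RatFunc ℂ

/-- The closed points of the projective line `ℂ ∪ {∞}`. -/
abbrev P1 : Type := OnePoint ℂ

/-- A local parameter at a point of the projective line: `t - a` at `a ∈ ℂ`, and `1/t` at `∞`. -/
def param (p : P1) : K :=
  p.elim (RatFunc.X)⁻¹ (fun a => RatFunc.X - RatFunc.C a)

/-- The derivative `du/dt` of the local parameter `u` at `p`: it is `1` at `a ∈ ℂ` and `-1/t²` at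
`∞`. -/
def dparam (p : P1) : K :=
  p.elim (-((RatFunc.X)⁻¹ ^ 2)) (fun _ => 1)

lemma param_ne_zero (p : P1) : param p ≠ 0 := by
  induction p using OnePoint.rec with
  | infty => exact inv_ne_zero RatFunc.X_ne_zero
  | coe a =>
    have h : (Polynomial.X - Polynomial.C a : Polynomial ℂ) ≠ 0 := Polynomial.X_sub_C_ne_zero a
    intro h0
    apply h
    apply RatFunc.algebraMap_injective ℂ
    rw [map_sub, RatFunc.algebraMap_X, RatFunc.algebraMap_C, map_zero]
    exact h0

lemma dparam_ne_zero (p : P1) : dparam p ≠ 0 := by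
  induction p using OnePoint.rec with
  | infty => exact neg_ne_zero.mpr (pow_ne_zero _ (inv_ne_zero RatFunc.X_ne_zero))
  | coe a => exact one_ne_zero

/-- The local ring of the projective line at `p`: with `u` the local parameter at `p`, the rational
functions of the form `A(u) / B(u)`, where `A` and `B` are polynomials and `B(0) ≠ 0`. -/
def localRing (p : P1) : Subalgebra ℂ K where
  carrier := {f | ∃ A B : Polynomial ℂ, B.eval 0 ≠ 0 ∧
    f * Polynomial.aeval (param p) B = Polynomial.aeval (param p) A}
  mul_mem' := by
    rintro f g ⟨A, B, hB, h⟩ ⟨A', B', hB', h'⟩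
    refine ⟨A * A', B * B', by simpa using ⟨hB, hB'⟩, ?_⟩
    rw [map_mul, map_mul, ← h, ← h']
    ring
  add_mem' := by
    rintro f g ⟨A, B, hB, h⟩ ⟨A', B', hB', h'⟩
    refine ⟨A * B' + A' * B, B * B', by simpa using ⟨hB, hB'⟩, ?_⟩
    rw [map_add, map_mul, map_mul, map_mul, ← h, ← h']
    ring
  algebraMap_mem' := fun c => ⟨Polynomial.C c, 1, by simp, by simp⟩

lemma param_mem (p : P1) : param p ∈ localRing p :=
  ⟨Polynomial.X, 1, by simp, by simp⟩

/-- The rational differential `f dt` is regular at `p`: it is `ρ du` with `ρ` in the local ring at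
`p` and `u` the local parameter at `p`. -/
def RegularFormAt (p : P1) (f : K) : Prop :=
  ∃ ρ ∈ localRing p, f = ρ * dparam p

/-! ### Binary curves -/

/-- A binary curve with nodes indexed by `N`: two copies `C₀`, `C₁` of the projective line, where for
every `h : N` the point `node 0 h` of `C₀` is glued to the point `node 1 h` of `C₁` to an ordinary
node. The arithmetic genus is the number of nodes minus one. -/
structure BinaryCurve (N : Type) where
  node : Fin 2 → N → P1
  node_injective : ∀ j, Function.Injective (node j)

namespace BinaryCurve

variable {N : Type} (C : BinaryCurve N)

/-- The local ring of the binary curve at the node `h`: the pairs of rational functions on the two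
components that are regular at the two points over the node and have the same value `c` there. -/
def nodeRing (h : N) : Subalgebra ℂ (Fin 2 → K) where
  carrier := {f | ∃ c : ℂ, ∀ j, ∃ ρ ∈ localRing (C.node j h),
    f j = algebraMap ℂ K c + param (C.node j h) * ρ}
  mul_mem' := by
    rintro f g ⟨c, hf⟩ ⟨d, hg⟩
    refine ⟨c * d, fun j => ?_⟩
    obtain ⟨ρ, hρ, e⟩ := hf j
    obtain ⟨ρ', hρ', e'⟩ := hg j
    refine ⟨algebraMap ℂ K c * ρ' + algebraMap ℂ K d * ρ + param (C.node j h) * (ρ * ρ'), ?_, ?_⟩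
    · exact add_mem (add_mem (mul_mem (algebraMap_mem _ c) hρ') (mul_mem (algebraMap_mem _ d) hρ))
        (mul_mem (param_mem _) (mul_mem hρ hρ'))
    · rw [Pi.mul_apply, e, e', map_mul]
      ring
  add_mem' := by
    rintro f g ⟨c, hf⟩ ⟨d, hg⟩
    refine ⟨c + d, fun j => ?_⟩
    obtain ⟨ρ, hρ, e⟩ := hf j
    obtain ⟨ρ', hρ', e'⟩ := hg j
    refine ⟨ρ + ρ', add_mem hρ hρ', ?_⟩
    rw [Pi.add_apply, e, e', map_add]
    ring
  algebraMap_mem' := fun c => ⟨c, fun j => ⟨0, zero_mem _, by simp⟩⟩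

/-- The restriction of germs of functions at the node `h` to the `j`-th component. -/
def branch (h : N) (j : Fin 2) : C.nodeRing h →ₐ[ℂ] K :=
  (Pi.evalAlgHom ℂ (fun _ : Fin 2 => K) j).comp (C.nodeRing h).val

/-- The points of the `j`-th component that are not nodes. -/
abbrev SmoothPoint (j : Fin 2) : Type := {p : P1 // p ∉ Set.range (C.node j)}

/-! A line bundle `A` of bidegree `(0, 0)` on the curve is given by a family `c : N → ℂˣ`: it is
trivial on both components, and its sections are the pairs `(s₀, s₁)` of functions on the components
with `s₀ = c h * s₁` at every node `h`. Two families give isomorphic bundles if and only if they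
differ by a constant factor. -/

/-- The components (divided by `dt`) of the local generator `ξ ⊗ l` of `ω_C ⊗ A` at the node `h`:
`ξ = (du₀/u₀, -du₁/u₁)` generates the dualizing sheaf `ω_C`, and `l = (c h, 1)` generates `A`. -/
def nodeGen (c : N → ℂˣ) (h : N) (j : Fin 2) : K :=
  algebraMap ℂ K (![(c h : ℂ), -1] j) * (dparam (C.node j h) / param (C.node j h))

lemma sign_ne_zero (c : N → ℂˣ) (h : N) (j : Fin 2) :
    algebraMap ℂ K (![(c h : ℂ), -1] j) ≠ 0 := by
  rw [Ne, map_eq_zero]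
  fin_cases j <;> simp

lemma nodeGen_ne_zero (c : N → ℂˣ) (h : N) (j : Fin 2) : C.nodeGen c h j ≠ 0 :=
  mul_ne_zero (sign_ne_zero c h j) (div_ne_zero (dparam_ne_zero _) (param_ne_zero _))

/-- The space `H⁰(C, ω_C ⊗ A)`. An element `σ` stands for the pair of rational differentials
`σ 0 dt`, `σ 1 dt` on the two components; they are regular away from the nodes, and at every node `h`
they have at most simple poles, with residues `c h * r` and `-r` for some `r`. -/
def prymForms (c : N → ℂˣ) : Submodule ℂ (Fin 2 → K) where
  carrier := {σ | (∀ j, ∀ p : C.SmoothPoint j, RegularFormAt p.1 (σ j)) ∧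
    ∀ h, ∃ r : ℂ, ∀ j, RegularFormAt (C.node j h) (σ j - algebraMap ℂ K r * C.nodeGen c h j)}
  zero_mem' := ⟨fun j p => ⟨0, zero_mem _, by simp⟩,
    fun h => ⟨0, fun j => ⟨0, zero_mem _, by simp⟩⟩⟩
  add_mem' := by
    rintro σ τ ⟨h1, h2⟩ ⟨h1', h2'⟩
    refine ⟨fun j p => ?_, fun h => ?_⟩
    · obtain ⟨ρ, hρ, e⟩ := h1 j p
      obtain ⟨ρ', hρ', e'⟩ := h1' j p
      exact ⟨ρ + ρ', add_mem hρ hρ', by rw [Pi.add_apply, e, e']; ring⟩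
    · obtain ⟨r, hr⟩ := h2 h
      obtain ⟨r', hr'⟩ := h2' h
      refine ⟨r + r', fun j => ?_⟩
      obtain ⟨ρ, hρ, e⟩ := hr j
      obtain ⟨ρ', hρ', e'⟩ := hr' j
      refine ⟨ρ + ρ', add_mem hρ hρ', ?_⟩
      rw [Pi.add_apply, add_mul, ← e, ← e', map_add]
      ring
  smul_mem' := by
    rintro z σ ⟨h1, h2⟩
    refine ⟨fun j p => ?_, fun h => ?_⟩
    · obtain ⟨ρ, hρ, e⟩ := h1 j p
      exact ⟨z • ρ, Subalgebra.smul_mem _ hρ z, by rw [Pi.smul_apply, e, smul_mul_assoc]⟩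
    · obtain ⟨r, hr⟩ := h2 h
      refine ⟨z * r, fun j => ?_⟩
      obtain ⟨ρ, hρ, e⟩ := hr j
      refine ⟨z • ρ, Subalgebra.smul_mem _ hρ z, ?_⟩
      rw [Pi.smul_apply, smul_mul_assoc, ← e, map_mul, Algebra.smul_def, Algebra.smul_def]
      ring

/-- The coefficient `f`, in the local ring at the node `h`, of a section `σ = f ξ ⊗ l` of
`ω_C ⊗ A`. -/
def nodeCoeff (c : N → ℂˣ) (h : N) : C.prymForms c →ₗ[ℂ] C.nodeRing h where
  toFun σ := ⟨fun j => σ.1 j / C.nodeGen c h j, by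
    obtain ⟨r, hr⟩ := σ.2.2 h
    refine ⟨r, fun j => ?_⟩
    obtain ⟨ρ, hρ, e⟩ := hr j
    refine ⟨algebraMap ℂ K (![(c h : ℂ), -1] j)⁻¹ * ρ, mul_mem (algebraMap_mem _ _) hρ, ?_⟩
    rw [sub_eq_iff_eq_add] at e
    have h1 := sign_ne_zero c h j
    have h2 := dparam_ne_zero (C.node j h)
    have h3 := param_ne_zero (C.node j h)
    change σ.1 j / C.nodeGen c h j = _
    rw [e, add_div, mul_div_cancel_right₀ _ (C.nodeGen_ne_zero c h j), add_comm, nodeGen, map_inv₀]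
    congr 1
    field_simp⟩
  map_add' σ τ := Subtype.ext (funext fun j => add_div _ _ _)
  map_smul' z σ := Subtype.ext (funext fun j => smul_div_assoc z (σ.1 j) (C.nodeGen c h j))

/-- The coefficient `f`, in the local ring at a smooth point `p` of the curve, of a section
`σ = f du` of `ω_C ⊗ A`, where `u` is the local parameter at `p`. -/
def smoothCoeff (c : N → ℂˣ) (j : Fin 2) (p : C.SmoothPoint j) :
    C.prymForms c →ₗ[ℂ] localRing p.1 where
  toFun σ := ⟨σ.1 j / dparam p.1, by
    obtain ⟨ρ, hρ, e⟩ := σ.2.1 j p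
    rw [e, mul_div_cancel_right₀ _ (dparam_ne_zero _)]
    exact hρ⟩
  map_add' σ τ := Subtype.ext (add_div _ _ _)
  map_smul' z σ := Subtype.ext (smul_div_assoc z (σ.1 j) (dparam p.1))

end BinaryCurve

/-! ### Kähler differentials and the local expression of the first Gaussian map -/

section Gaussian

variable {V S S' : Type} [AddCommGroup V] [Module ℂ V] [CommRing S] [Algebra ℂ S]
  [CommRing S'] [Algebra ℂ S']

/-- The map on Kähler differentials induced by a homomorphism of `ℂ`-algebras. -/
def kaehlerMap (φ : S →ₐ[ℂ] S') : Ω[S⁄ℂ] →ₗ[ℂ] Ω[S'⁄ℂ] :=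
  letI := φ.toRingHom.toAlgebra
  haveI : IsScalarTower ℂ S S' := IsScalarTower.of_algebraMap_eq' φ.comp_algebraMap.symm
  (KaehlerDifferential.map ℂ ℂ S S').restrictScalars ℂ

lemma kaehlerMap_smul_D (φ : S →ₐ[ℂ] S') (x y : S) :
    kaehlerMap φ (x • KaehlerDifferential.D ℂ S y) =
      φ x • KaehlerDifferential.D ℂ S' (φ y) := by
  let _ := φ.toRingHom.toAlgebra
  have : IsScalarTower ℂ S S' := IsScalarTower.of_algebraMap_eq' φ.comp_algebraMap.symm
  change KaehlerDifferential.map ℂ ℂ S S' (x • KaehlerDifferential.D ℂ S y) = _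
  rw [map_smul, KaehlerDifferential.map_D, algebra_compatible_smul S' x]
  rfl

/-- The alternating map `(σ₁, σ₂) ↦ f₁ df₂ - f₂ df₁`, where `fᵢ` is the local coefficient of
`σᵢ`. -/
def wronskian (coeff : V →ₗ[ℂ] S) : V [⋀^Fin 2]→ₗ[ℂ] Ω[S⁄ℂ] where
  toFun v := coeff (v 0) • KaehlerDifferential.D ℂ S (coeff (v 1)) -
    coeff (v 1) • KaehlerDifferential.D ℂ S (coeff (v 0))
  map_update_add' := by
    intro _ m i x y
    fin_cases i <;> simp [add_smul, smul_add] <;> abel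
  map_update_smul' := by
    intro _ m i z x
    fin_cases i
    · simp [smul_sub, smul_comm (coeff (m 1)) z]
    · simp [smul_sub, smul_comm (coeff (m 0)) z]
  map_eq_zero_of_eq' := by
    intro v i j hv hij
    have h : v 0 = v 1 := by
      fin_cases i <;> fin_cases j <;> simp_all
    rw [h, sub_self]

/-- The linear map `Λ² V → Ω¹` with `σ₁ ∧ σ₂ ↦ f₁ df₂ - f₂ df₁`. -/
def localGaussian (coeff : V →ₗ[ℂ] S) : ⋀[ℂ]^2 V →ₗ[ℂ] Ω[S⁄ℂ] :=
  exteriorPower.alternatingMapLinearEquiv (wronskian coeff)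

end Gaussian

namespace BinaryCurve

variable {N : Type} (C : BinaryCurve N)

/-- The product, over all closed points of the curve, of the stalks of `(ω_C ⊗ A)² ⊗ Ω¹_C`, where
`ω_C ⊗ A` is trivialized at every point by the local generator chosen above: the Kähler
differentials of the local rings. -/
abbrev Stalks : Type :=
  (∀ h : N, Ω[C.nodeRing h⁄ℂ]) × (∀ (j : Fin 2) (p : C.SmoothPoint j), Ω[localRing p.1⁄ℂ])

/-- The space `H⁰(C, (ω_C ⊗ A)² ⊗ Ω¹_C)`: the families of germs at the closed points that have, on
both components, the same image `w j (dt)²` in the stalk at the generic point. (The sheaf is locally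
free away from the nodes, so two germs that agree generically agree near, but outside, their base
points; hence such families are exactly the global sections.) -/
def gaussTarget (c : N → ℂˣ) : Submodule ℂ C.Stalks where
  carrier := {s | ∃ w : Fin 2 → Ω[K⁄ℂ],
    (∀ h j, (C.nodeGen c h j) ^ 2 • kaehlerMap (C.branch h j) (s.1 h) = w j) ∧
    ∀ j, ∀ p : C.SmoothPoint j, (dparam p.1) ^ 2 • kaehlerMap (localRing p.1).val (s.2 j p) = w j}
  zero_mem' := ⟨0, fun h j => by simp, fun j p => by simp⟩
  add_mem' := by
    rintro s s' ⟨w, h1, h2⟩ ⟨w', h1', h2'⟩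
    refine ⟨w + w', fun h j => ?_, fun j p => ?_⟩
    · simp only [Prod.fst_add, Pi.add_apply, map_add, smul_add, h1, h1']
    · simp only [Prod.snd_add, Pi.add_apply, map_add, smul_add, h2, h2']
  smul_mem' := by
    rintro z s ⟨w, h1, h2⟩
    refine ⟨z • w, fun h j => ?_, fun j p => ?_⟩
    · rw [Prod.smul_fst, Pi.smul_apply, map_smul, smul_comm, h1, Pi.smul_apply]
    · rw [Prod.smul_snd, Pi.smul_apply, Pi.smul_apply, map_smul, smul_comm, h2, Pi.smul_apply]

/-- The family of the local expressions of the first Gaussian map. -/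
def gaussFamily (c : N → ℂˣ) : ⋀[ℂ]^2 (C.prymForms c) →ₗ[ℂ] C.Stalks :=
  LinearMap.prod (LinearMap.pi fun h => localGaussian (C.nodeCoeff c h))
    (LinearMap.pi fun j => LinearMap.pi fun p => localGaussian (C.smoothCoeff c j p))

lemma smul_kaehlerMap_localGaussian {V S : Type} [AddCommGroup V] [Module ℂ V] [CommRing S]
    [Algebra ℂ S] (coeff : V →ₗ[ℂ] S) (φ : S →ₐ[ℂ] K) (e : K) (ψ : V →ₗ[ℂ] K)
    (hψ : ∀ v, ψ v = e * φ (coeff v)) (x : ⋀[ℂ]^2 V) :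
    e ^ 2 • kaehlerMap φ (localGaussian coeff x) = localGaussian ψ x := by
  have h : (LinearMap.lsmul K Ω[K⁄ℂ] (e ^ 2)).restrictScalars ℂ ∘ₗ kaehlerMap φ ∘ₗ
      localGaussian coeff = localGaussian ψ := by
    apply exteriorPower.linearMap_ext
    ext v
    simp only [LinearMap.compAlternatingMap_apply, LinearMap.comp_apply,
      LinearMap.restrictScalars_apply, LinearMap.lsmul_apply,
      localGaussian, exteriorPower.alternatingMapLinearEquiv_apply_ιMulti]
    simp only [wronskian, AlternatingMap.coe_mk, MultilinearMap.coe_mk, map_sub,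
      kaehlerMap_smul_D, hψ, Derivation.leibniz]
    generalize KaehlerDifferential.D ℂ K (φ (coeff (v 0))) = x
    generalize KaehlerDifferential.D ℂ K (φ (coeff (v 1))) = y
    generalize KaehlerDifferential.D ℂ K e = z
    generalize φ (coeff (v 0)) = p
    generalize φ (coeff (v 1)) = q
    have h1 : e ^ 2 * p = (e * p) * e := by ring
    have h2 : e ^ 2 * q = (e * q) * e := by ring
    have h3 : (e * p) * q = (e * q) * p := by ring
    simp only [smul_sub, smul_add, smul_smul, h1, h2, h3]
    abel
  exact LinearMap.congr_fun h x

/-- The first Gaussian map `μ_A : Λ² H⁰(C, ω_C ⊗ A) → H⁰(C, (ω_C ⊗ A)² ⊗ Ω¹_C)`, locally given by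
`(f₁ ξ ⊗ l) ∧ (f₂ ξ ⊗ l) ↦ (f₁ df₂ - f₂ df₁) ξ² ⊗ l²`. -/
def gaussianMap (c : N → ℂˣ) : ⋀[ℂ]^2 (C.prymForms c) →ₗ[ℂ] C.gaussTarget c :=
  LinearMap.codRestrict (C.gaussTarget c) (C.gaussFamily c) fun x =>
    ⟨fun j => localGaussian (LinearMap.proj j ∘ₗ (C.prymForms c).subtype) x,
      fun h j => smul_kaehlerMap_localGaussian _ _ _ _
        (fun σ => (mul_div_cancel₀ (σ.1 j) (C.nodeGen_ne_zero c h j)).symm) x,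
      fun j p => smul_kaehlerMap_localGaussian _ _ _ _
        (fun σ => (mul_div_cancel₀ (σ.1 j) (dparam_ne_zero p.1)).symm) x⟩

end BinaryCurve

/-! ### Prym-canonical binary curves of genus `g` -/

/-- The indices of the `g + 1` nodes: `P₁, …, P_{g-1}`, then `P_g` (over `0`) and `P_{g+1}`
(over `∞`). -/
inductive NodeIndex (g : ℕ) : Type
  | affine (i : Fin (g - 1))
  | zero
  | infty

/-- The positions of the nodes for the parameters `a`: on the `j`-th component they are
`a_{1,j}, …, a_{g-1,j}, 0, ∞`. -/
def nodePos {g : ℕ} (a : Fin 2 × Fin (g - 1) → ℂ) (j : Fin 2) : NodeIndex g → P1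
  | NodeIndex.affine i => ((a (j, i) : ℂ) : P1)
  | NodeIndex.zero => ((0 : ℂ) : P1)
  | NodeIndex.infty => OnePoint.infty

/-- The parameters define a binary curve: on each component the nodes are distinct. -/
def Admissible {g : ℕ} (a : Fin 2 × Fin (g - 1) → ℂ) : Prop :=
  ∀ j, Function.Injective (nodePos a j)

/-- The binary curve of genus `g` with the parameters `a`. -/
def prymCurve {g : ℕ} (a : Fin 2 × Fin (g - 1) → ℂ) (ha : Admissible a) :
    BinaryCurve (NodeIndex g) :=
  ⟨nodePos a, ha⟩

/-- The nontrivial two-torsion line bundle `A`: the gluing factors are `1` at `P₁, …, P_k`, `-1` at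
`P_{k+1}, …, P_{g-1}`, `-1` at `P_g` and `1` at `P_{g+1}`, where `k = ⌊g/2⌋`. -/
def prymBundle (g : ℕ) : NodeIndex g → ℂˣ
  | NodeIndex.affine i => if i.val < g / 2 then 1 else -1
  | NodeIndex.zero => -1
  | NodeIndex.infty => 1

/-- A property holds for a general point of the affine space `ℂ^σ`: it holds on a nonempty
Zariski-open subset, that is, wherever some nonzero polynomial does not vanish. -/
def ForGeneral {σ : Type} (P : (σ → ℂ) → Prop) : Prop :=
  ∃ F : MvPolynomial σ ℂ, F ≠ 0 ∧ ∀ a : σ → ℂ, MvPolynomial.eval a F ≠ 0 → P a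

end PrymBinary

end

/-! Injectivity of the first Gaussian map of a general Prym-canonical binary curve. At every node the
Kähler differentials give linear conditions on the exterior square of the space of sections, written
in the coordinates given by the residues. The resulting system of linear equations has only the
trivial solution for general nodes, because this is so for special nodes modulo `13`. -/

noncomputable section

namespace PrymBinary

/-! ### Gaussian elimination on packed rows -/

section Elimination

variable (p B : ℕ)

/-! On each component a section of ω_C ⊗ A is a rational differential with at most simple poles, all
at nodes. The residue theorem on the two components gives Σ c_h r_h = 0 and Σ r_h = 0, so the r_h
with c_h = 1 sum to zero, and so do those with c_h = -1. Hence the residues at 0 and ∞ follow from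
the n = g - 1 residues r_i at the other ("affine") nodes, and partial fractions recover the section
from these (`prymForm_eq_sum`). An element of the exterior square is therefore determined by its
n(n-1)/2 coordinates r_i ∧ r_j (`eq_zero_of_wedge_eq_zero`).

If μ_A kills x, then so does every linear form on the Kähler differentials of a node ring, composed
with the local expression f₁ df₂ - f₂ df₁. The coefficients of 1 and u on a branch give r_h ∧ (first
jet) and r_h ∧ (second jet), and the torsion of Ω¹ gives (first jet on one branch) ∧ (first jet on
the other) (`wedge_jet_one_one`). Four branch conditions at every affine node and one torsion
condition at every node make 5n + 2 linear equations. Modulo torsion the image is a section of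
degree 2g - 4 = 2n - 2 on each component, so its 2n coefficients at the affine nodes determine it
and satisfy a linear relation. The equations thus have rank at most 5n, and n(n-1)/2 ≤ 5n holds
exactly for n ≤ 11, with equality at g = 12.

The system has trivial kernel for explicit nodes modulo 13, by computation
(`eliminate_sampleEquations`). Its matrix M has entries in ℤ[a][1/D], where D vanishes when nodes
collide or are zero. If an integer matrix N lifts a left inverse modulo 13, then det(N M) is 1 at
the sample nodes modulo 13, so it is not zero, and its numerator times D is the required polynomial
(`exists_polynomial_conditionMatrix`). -/

/-- The number with the digits `ds` in base `B`, the lowest digit first. -/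
def packDigits (ds : List ℕ) : ℕ :=
  ds.foldr (fun d N => d + B * N) 0

/-- Split off the first row whose lowest digit is nonzero modulo `p`. -/
def findPivot : List ℕ → Option (ℕ × List ℕ)
  | [] => none
  | N :: rows =>
    if N % B % p = 0 then (findPivot rows).map fun q => (q.1, N :: q.2) else some (N, rows)

/-- Eliminate the lowest digit from the given rows by the row `P`, and put the resulting nonzero rows
in front of `acc`. (The case distinction makes the kernel evaluate every row at once.) -/
def reduceRows (P : ℕ) : List ℕ → List ℕ → List ℕ
  | [], acc => acc
  | N :: rows, acc =>
    match (P % B % p * N + (p - N % B % p) * P) / B with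
    | 0 => reduceRows P rows acc
    | M + 1 => reduceRows P rows ((M + 1) :: acc)

/-- Gaussian elimination modulo `p`, on a matrix with `m` columns whose rows are packed in base
`B`: the value is `true` if there is a pivot in every column. -/
def eliminate : ℕ → List ℕ → Bool
  | 0, _ => true
  | m + 1, rows =>
    match findPivot p B rows with
    | none => false
    | some q => eliminate m (reduceRows p B q.1 q.2 [])

/-- The number `N` packs a row of length `m` with entries less than `b` that is orthogonal to `x`
modulo `p`. -/
def Annihilates (b m : ℕ) (x : ℕ → ZMod p) (N : ℕ) : Prop :=
  ∃ d : ℕ → ℕ, N = ∑ i ∈ Finset.range m, d i * B ^ i ∧ (∀ i, d i < b) ∧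
    ∑ i ∈ Finset.range m, (d i : ZMod p) * x i = 0

variable {p B}

lemma findPivot_some {rows : List ℕ} {q : ℕ × List ℕ} (h : findPivot p B rows = some q) :
    q.1 ∈ rows ∧ (∀ N ∈ q.2, N ∈ rows) ∧ q.1 % B % p ≠ 0 := by
  induction rows generalizing q with
  | nil => simp [findPivot] at h
  | cons N rows ih =>
    rw [findPivot] at h
    split_ifs at h with h0
    · obtain ⟨q', hq', rfl⟩ := Option.map_eq_some_iff.mp h
      obtain ⟨h1, h2, h3⟩ := ih hq'
      refine ⟨List.mem_cons_of_mem _ h1, fun M hM => ?_, h3⟩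
      rcases List.mem_cons.mp hM with rfl | hM
      · exact List.mem_cons_self
      · exact List.mem_cons_of_mem _ (h2 M hM)
    · obtain rfl := Option.some.inj h
      exact ⟨List.mem_cons_self, fun M hM => List.mem_cons_of_mem _ hM, h0⟩

/-- Only soundness is needed: every output row is a combination of an input row with the pivot row.
Discarding rows only weakens the system. -/
lemma mem_reduceRows {P M : ℕ} {rows acc : List ℕ} (h : M ∈ reduceRows p B P rows acc) :
    M ∈ acc ∨ ∃ N ∈ rows, (P % B % p * N + (p - N % B % p) * P) / B = M := by
  induction rows generalizing acc with
  | nil => exact Or.inl h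
  | cons N rows ih =>
    rw [reduceRows] at h
    split at h
    · exact (ih h).imp_right fun ⟨N', hN', e⟩ => ⟨N', List.mem_cons_of_mem _ hN', e⟩
    · rename_i v hv
      rcases ih h with h | ⟨N', hN', e⟩
      · rcases List.mem_cons.mp h with rfl | h
        · exact Or.inr ⟨N, List.mem_cons_self, hv⟩
        · exact Or.inl h
      · exact Or.inr ⟨N', List.mem_cons_of_mem _ hN', e⟩

lemma sum_digits_succ (d : ℕ → ℕ) (m : ℕ) :
    ∑ i ∈ Finset.range (m + 1), d i * B ^ i =
      d 0 + B * ∑ i ∈ Finset.range m, d (i + 1) * B ^ i := by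
  rw [Finset.sum_range_succ', Finset.mul_sum, add_comm]
  congr 1
  · simp
  · exact Finset.sum_congr rfl fun i _ => by ring

/-- Back substitution: the reduced rows force the later unknowns to vanish, and then the pivot row
forces the first. Digits are never reduced modulo p, so a step can multiply their bound by 2p; the
bound on `B` rules out carries through all steps. -/
lemma eq_zero_of_eliminate [Fact p.Prime] (m : ℕ) (rows : List ℕ) (b : ℕ) (x : ℕ → ZMod p)
    (hb : b * (2 * p) ^ m ≤ B) (hrows : ∀ N ∈ rows, Annihilates p B b m x N)
    (h : eliminate p B m rows = true) : ∀ i < m, x i = 0 := by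
  induction m generalizing rows b x with
  | zero => intro i hi; omega
  | succ m ih =>
    have hp : 0 < p := (Fact.out : p.Prime).pos
    have hbB : b * (2 * p) ≤ B := by
      refine le_trans ?_ hb
      rw [pow_succ']
      exact Nat.mul_le_mul_left _ (Nat.le_mul_of_pos_right _ (by positivity))
    have hb1 : b ≤ B := (Nat.le_mul_of_pos_right b (by omega)).trans hbB
    rw [eliminate] at h
    cases hq : findPivot p B rows with
    | none => simp [hq] at h
    | some q =>
      simp only [hq] at h
      obtain ⟨h1, h2, h3⟩ := findPivot_some hq
      obtain ⟨e, he, heb, hex⟩ := hrows _ h1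
      rw [sum_digits_succ] at he
      have hhead : ∀ (d : ℕ → ℕ) (N S : ℕ), (∀ i, d i < b) → N = d 0 + B * S → N % B = d 0 := by
        rintro d N S hd rfl
        rw [Nat.add_mul_mod_self_left, Nat.mod_eq_of_lt ((hd 0).trans_le hb1)]
      have he0 := hhead e _ _ heb he
      rw [he0] at h3
      have htail : ∀ i < m, x (i + 1) = 0 := by
        refine ih _ (b * (2 * p)) (fun i => x (i + 1)) ?_ ?_ h
        · rw [mul_assoc, ← pow_succ']; exact hb
        · intro M hM
          obtain ⟨N, hN, rfl⟩ := (mem_reduceRows hM).resolve_left List.not_mem_nil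
          obtain ⟨d, hd, hdb, hdx⟩ := hrows _ (h2 N hN)
          rw [sum_digits_succ] at hd
          have hd0 := hhead d _ _ hdb hd
          rw [hd0, he0]
          -- Modulo p, s is e 0 and t is -d 0, so s N + t P has lowest digit divisible by p. That
          -- digit is less than `B`, so the division by `B` drops it without a carry.
          set s := e 0 % p
          set t := p - d 0 % p
          have hs : s ≤ p := (Nat.mod_lt _ hp).le
          have ht : t ≤ p := Nat.sub_le _ _
          have hlt : ∀ i, s * d i + t * e i < b * (2 * p) := by
            intro i
            have hs1 : 0 < s := Nat.pos_of_ne_zero h3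
            calc s * d i + t * e i < s * b + t * b :=
                  add_lt_add_of_lt_of_le (Nat.mul_lt_mul_of_pos_left (hdb i) hs1)
                    (Nat.mul_le_mul_left _ (heb i).le)
              _ ≤ p * b + p * b :=
                  add_le_add (Nat.mul_le_mul_right _ hs) (Nat.mul_le_mul_right _ ht)
              _ = b * (2 * p) := by ring
          refine ⟨fun i => s * d (i + 1) + t * e (i + 1), ?_, fun i => hlt _, ?_⟩
          · rw [hd, he]
            have : s * (d 0 + B * ∑ i ∈ Finset.range m, d (i + 1) * B ^ i) +
                t * (e 0 + B * ∑ i ∈ Finset.range m, e (i + 1) * B ^ i) =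
                (s * d 0 + t * e 0) + B * ∑ i ∈ Finset.range m,
                  (s * d (i + 1) + t * e (i + 1)) * B ^ i := by
              simp only [add_mul, Finset.sum_add_distrib, mul_assoc, ← Finset.mul_sum]
              ring
            have hB : 0 < B := (Nat.zero_le _).trans_lt ((hlt 0).trans_le hbB)
            rw [this, Nat.add_mul_div_left _ _ hB, Nat.div_eq_of_lt ((hlt 0).trans_le hbB), zero_add]
          · rw [Finset.sum_range_succ'] at hdx hex
            have hs' : (s : ZMod p) = (e 0 : ZMod p) := ZMod.natCast_mod _ _
            have ht' : (t : ZMod p) = -(d 0 : ZMod p) := by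
              rw [Nat.cast_sub (Nat.mod_lt _ hp).le, ZMod.natCast_self, ZMod.natCast_mod, zero_sub]
            push_cast
            simp only [add_mul, Finset.sum_add_distrib, mul_assoc, ← Finset.mul_sum, hs', ht']
            -- The two terms in x 0 cancel, so the relation involves only the remaining unknowns.
            linear_combination (e 0 : ZMod p) * hdx - (d 0 : ZMod p) * hex
      have hx0 : x 0 = 0 := by
        rw [Finset.sum_range_succ', Finset.sum_eq_zero, zero_add] at hex
        · refine (mul_eq_zero.mp hex).resolve_left fun h0 => h3 ?_
          exact Nat.mod_eq_zero_of_dvd ((ZMod.natCast_eq_zero_iff _ _).mp h0)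
        · intro i hi
          rw [htail i (Finset.mem_range.mp hi), mul_zero]
      rintro (_ | i) hi
      · exact hx0
      · exact htail i (by omega)

lemma packDigits_eq_sum (ds : List ℕ) :
    packDigits B ds = ∑ i ∈ Finset.range ds.length, ds.getD i 0 * B ^ i := by
  induction ds with
  | nil => simp [packDigits]
  | cons d ds ih =>
    rw [List.length_cons, sum_digits_succ]
    simp only [List.getD_cons_zero, List.getD_cons_succ, ← ih]
    rfl

lemma sum_getD_mul {α F : Type*} [CommRing F] (L : List α) (e : α → ℕ) (X : α → F) :
    ∑ i ∈ Finset.range L.length, ((L.map e).getD i 0 : F) * (L.map X).getD i 0 =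
      (L.map fun q => (e q : F) * X q).sum := by
  induction L with
  | nil => simp
  | cons q L ih =>
    rw [List.length_cons, Finset.sum_range_succ', add_comm]
    simp only [List.map_cons, List.getD_cons_zero, List.getD_cons_succ, ih, List.sum_cons]

/-- If elimination finds a pivot in every column, then the linear system whose equations have the
coefficients `e q`, `e ∈ E`, at the unknowns `q ∈ L` has only the trivial solution modulo `p`. -/
lemma eq_zero_of_eliminate_map [Fact p.Prime] {α : Type*} (L : List α) (E : List (α → ℕ))
    (X : α → ZMod p) (hB : p * (2 * p) ^ L.length ≤ B)
    (hE : ∀ e ∈ E, (L.map fun q => (e q : ZMod p) * X q).sum = 0)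
    (h : eliminate p B L.length (E.map fun e => packDigits B (L.map fun q => e q % p)) = true) :
    ∀ q ∈ L, X q = 0 := by
  have hp : 0 < p := (Fact.out : p.Prime).pos
  have key := eq_zero_of_eliminate L.length _ p (fun i => (L.map X).getD i 0) hB ?_ h
  · intro q hq
    obtain ⟨i, hi, rfl⟩ := List.mem_iff_getElem.mp hq
    have := key i hi
    rwa [List.getD_eq_getElem _ _ (by simpa using hi), List.getElem_map] at this
  · intro N hN
    obtain ⟨e, he, rfl⟩ := List.mem_map.mp hN
    refine ⟨fun i => (L.map fun q => e q % p).getD i 0, ?_, fun i => ?_, ?_⟩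
    · rw [packDigits_eq_sum, List.length_map]
    · beta_reduce
      by_cases hi : i < (L.map fun q => e q % p).length
      · rw [List.getD_eq_getElem _ _ hi, List.getElem_map]
        exact Nat.mod_lt _ hp
      · rw [List.getD_eq_default _ _ (not_lt.mp hi)]
        exact hp
    · rw [sum_getD_mul, ← hE e he]
      simp only [ZMod.natCast_mod]

end Elimination

/-! ### A system of linear equations modulo `13` -/

/-- The index pairs `(i, j)` with `i < j < n`. -/
def pairList (n : ℕ) : List (ℕ × ℕ) :=
  (List.range n).flatMap fun j => (List.range j).map fun i => (i, j)

/-- The nodes `1, 2, 3, …` on the first and `1, 2, 4, …` on the second component. -/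
def sampleNode (j i : ℕ) : ℕ :=
  if j = 0 then i + 1 else 2 ^ i

/-- A representative modulo `13` of the sign of the `i`-th residue on the `j`-th component. -/
def sampleSign (k j i : ℕ) : ℕ :=
  if i < k then 1 else if j = 0 then 12 else 1

/-- A representative modulo `13` of the first Taylor coefficient at the `h`-th node of the `i`-th
section. -/
def sampleJetOne (k j h i : ℕ) : ℕ :=
  sampleSign k j i * ((if i = h then 0 else (sampleNode j h + 12 * sampleNode j i) ^ 11) +
    12 * if i < k then 0 else sampleNode j h ^ 11)

/-- A representative modulo `13` of the second Taylor coefficient, up to sign. -/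
def sampleJetTwo (k j h i : ℕ) : ℕ :=
  sampleSign k j i * ((if i = h then 0 else (sampleNode j h + 12 * sampleNode j i) ^ 22) +
    12 * if i < k then 0 else sampleNode j h ^ 22)

/-- A representative modulo `13` of the `2 × 2` minor of `u`, `v` at an index pair. -/
def sampleWedge (u v : ℕ → ℕ) (q : ℕ × ℕ) : ℕ :=
  u q.1 * v q.2 + 12 * (u q.2 * v q.1)

/-- The equations, as functions of the index pairs. -/
def sampleEquations (n k : ℕ) : List (ℕ × ℕ → ℕ) :=
  ((List.range n).flatMap fun h =>
    [sampleWedge (fun i => if i = h then 1 else 0) (sampleJetOne k 0 h),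
      sampleWedge (fun i => if i = h then 1 else 0) (sampleJetTwo k 0 h),
      sampleWedge (fun i => if i = h then 1 else 0) (sampleJetOne k 1 h),
      sampleWedge (fun i => if i = h then 1 else 0) (sampleJetTwo k 1 h),
      sampleWedge (sampleJetOne k 0 h) (sampleJetOne k 1 h)]) ++
  [sampleWedge (fun i => sampleSign k 0 i * sampleNode 0 i)
      (fun i => sampleSign k 1 i * sampleNode 1 i),
    sampleWedge (fun i => sampleSign k 0 i * sampleNode 0 i ^ 11)
      (fun i => sampleSign k 1 i * sampleNode 1 i ^ 11)]

/-- The only computation. Here n is g - 1 and (n + 1) / 2 is k; the largest case has 55 unknowns and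
57 equations. A row operation is a few operations on large natural numbers, since a whole row is one
number. -/
lemma eliminate_sampleEquations : ∀ n < 12, eliminate 13 (2 ^ 300) (pairList n).length
    ((sampleEquations n ((n + 1) / 2)).map fun e =>
      packDigits (2 ^ 300) ((pairList n).map fun q => e q % 13)) = true := by
  decide +kernel

/-! ### The linear conditions imposed by the Gaussian map at the nodes -/

section Conditions

variable {S S' : Type*} [CommRing S] [CommRing S'] {n : ℕ} (k : ℕ) (a : Fin 2 × Fin n → S)

/-- The sign of the `i`-th residue on the `j`-th component. -/
def compSign (S : Type*) [CommRing S] (k : ℕ) (j : Fin 2) (i : Fin n) : S :=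
  if i.val < k then 1 else if j = 0 then -1 else 1

/-- The coefficient of `u` in the expansion at the `h`-th node, with local parameter `u`, of the
`i`-th section on the `j`-th component, as a multiple of `du / u`. -/
def jetOne (j : Fin 2) (h i : Fin n) : S :=
  compSign S k j i * ((if i = h then 0 else Ring.inverse (a (j, h) - a (j, i))) -
    if i.val < k then 0 else Ring.inverse (a (j, h)))

/-- The negative of the coefficient of `u ^ 2` in the same expansion. -/
def jetTwo (j : Fin 2) (h i : Fin n) : S :=
  compSign S k j i * ((if i = h then 0 else Ring.inverse (a (j, h) - a (j, i)) ^ 2) -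
    if i.val < k then 0 else Ring.inverse (a (j, h)) ^ 2)

/-- The index pairs `i < j`, a basis of the second exterior power of an `n`-dimensional space. -/
abbrev Pair (n : ℕ) : Type := {q : Fin n × Fin n // q.1 < q.2}

/-- The indices of the conditions: five at every node different from `0` and `∞`, and one at each of
`∞` and `0`. -/
abbrev Condition (n : ℕ) : Type := (Fin n × Fin 5) ⊕ Fin 2

/-- Every condition is an alternating form `u ∧ v`. -/
def conditionForms : Condition n → (Fin n → S) × (Fin n → S)
  | Sum.inl (h, s) =>
    ![(Pi.single h 1, jetOne k a 0 h), (Pi.single h 1, jetTwo k a 0 h),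
      (Pi.single h 1, jetOne k a 1 h), (Pi.single h 1, jetTwo k a 1 h),
      (jetOne k a 0 h, jetOne k a 1 h)] s
  | Sum.inr s =>
    ![(fun i => compSign S k 0 i * a (0, i), fun i => compSign S k 1 i * a (1, i)),
      (fun i => compSign S k 0 i * Ring.inverse (a (0, i)),
        fun i => compSign S k 1 i * Ring.inverse (a (1, i)))] s

/-- The matrix of the conditions. -/
def conditionMatrix : Matrix (Condition n) (Pair n) S :=
  Matrix.of fun c q =>
    (conditionForms k a c).1 q.1.1 * (conditionForms k a c).2 q.1.2 -
      (conditionForms k a c).1 q.1.2 * (conditionForms k a c).2 q.1.1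

/-- The nodes on each component are distinct and nonzero, in the strong sense that the relevant
elements are units. -/
def Separated : Prop :=
  ∀ j, (∀ i, IsUnit (a (j, i))) ∧ ∀ h i, h ≠ i → IsUnit (a (j, h) - a (j, i))

variable {k a}

lemma map_ringInverse (φ : S →+* S') {x : S} (hx : IsUnit x) :
    φ (Ring.inverse x) = Ring.inverse (φ x) := by
  obtain ⟨u, rfl⟩ := hx
  rw [Ring.inverse_unit, ← MonoidHom.coe_coe, ← Units.coe_map, ← Units.coe_map, Ring.inverse_unit,
    ← map_inv]

lemma map_compSign (φ : S →+* S') (j : Fin 2) (i : Fin n) :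
    φ (compSign S k j i) = compSign S' k j i := by
  unfold compSign
  split_ifs <;> simp

lemma map_jetOne (φ : S →+* S') (ha : Separated a) (j : Fin 2) (h i : Fin n) :
    φ (jetOne k a j h i) = jetOne k (φ ∘ a) j h i := by
  have h1 := map_ringInverse φ ((ha j).1 h)
  simp only [jetOne, map_mul, map_sub, map_compSign, Function.comp_apply, apply_ite φ, h1, map_zero]
  congr 2
  split_ifs with hi
  · rfl
  · rw [map_ringInverse φ ((ha j).2 h i (Ne.symm hi)), map_sub]

lemma map_jetTwo (φ : S →+* S') (ha : Separated a) (j : Fin 2) (h i : Fin n) :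
    φ (jetTwo k a j h i) = jetTwo k (φ ∘ a) j h i := by
  have h1 := map_ringInverse φ ((ha j).1 h)
  simp only [jetTwo, map_mul, map_sub, map_compSign, Function.comp_apply, apply_ite φ, h1, map_zero,
    map_pow]
  congr 2
  split_ifs with hi
  · rfl
  · rw [map_ringInverse φ ((ha j).2 h i (Ne.symm hi)), map_sub]

lemma map_conditionForms (φ : S →+* S') (ha : Separated a) (c : Condition n) (i : Fin n) :
    φ ((conditionForms k a c).1 i) = (conditionForms k (φ ∘ a) c).1 i ∧
      φ ((conditionForms k a c).2 i) = (conditionForms k (φ ∘ a) c).2 i := by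
  have hs : ∀ h : Fin n, φ (Pi.single (M := fun _ => S) h 1 i) =
      Pi.single (M := fun _ => S') h 1 i := by
    intro h
    simp only [Pi.single_apply, apply_ite φ, map_one, map_zero]
  rcases c with ⟨h, s⟩ | s
  · fin_cases s <;> simp [conditionForms, hs, map_jetOne φ ha, map_jetTwo φ ha]
  · fin_cases s <;> simp [conditionForms, map_compSign, map_ringInverse φ ((ha 0).1 i),
      map_ringInverse φ ((ha 1).1 i)]

/-- `Ring.inverse` commutes with a ring homomorphism at units, hence the need for `Separated`. This
lets one matrix over a localization of ℤ[a] specialize both to ZMod 13 and to ℂ. -/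
lemma map_conditionMatrix (φ : S →+* S') (ha : Separated a) :
    (conditionMatrix k a).map φ = conditionMatrix k (φ ∘ a) := by
  ext c q
  simp [conditionMatrix, (map_conditionForms φ ha c _).1, (map_conditionForms φ ha c _).2]

end Conditions

/-! ### Injectivity for the sample nodes -/

section Sample

variable {n : ℕ} (k : ℕ)

/-- The sample nodes modulo `13`. -/
def sampleNodes (n : ℕ) (q : Fin 2 × Fin n) : ZMod 13 :=
  (sampleNode q.1 q.2 : ℕ)

lemma pairList_nodup (n : ℕ) : (pairList n).Nodup := by
  refine List.nodup_flatMap.mpr ⟨fun j _ => ?_, ?_⟩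
  · exact List.nodup_range.map fun _ _ h => (Prod.mk.inj h).1
  · refine List.nodup_range.imp fun {j j'} hj => ?_
    intro q hq hq'
    obtain ⟨i, -, rfl⟩ := List.mem_map.mp hq
    obtain ⟨i', -, e⟩ := List.mem_map.mp hq'
    exact hj (Prod.mk.inj e).2.symm

lemma mem_pairList {n : ℕ} {q : ℕ × ℕ} : q ∈ pairList n ↔ q.1 < q.2 ∧ q.2 < n := by
  obtain ⟨i, j⟩ := q
  simp only [pairList, List.mem_flatMap, List.mem_range, List.mem_map, Prod.mk.injEq]
  constructor
  · rintro ⟨j', hj', i', hi', rfl, rfl⟩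
    exact ⟨hi', hj'⟩
  · rintro ⟨h1, h2⟩
    exact ⟨j, h2, i, h1, rfl, rfl⟩

lemma sum_pairList {M : Type*} [AddCommMonoid M] (n : ℕ) (f : ℕ × ℕ → M) :
    ((pairList n).map f).sum = ∑ q : Pair n, f (q.1.1, q.1.2) := by
  rw [← List.sum_toFinset f (pairList_nodup n)]
  refine (Finset.sum_bij (fun (q : Pair n) _ => ((q.1.1 : ℕ), (q.1.2 : ℕ))) ?_ ?_ ?_ ?_).symm
  · intro q _
    exact List.mem_toFinset.mpr (mem_pairList.mpr ⟨q.2, q.1.2.isLt⟩)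
  · rintro ⟨⟨i, j⟩, hq⟩ _ ⟨⟨i', j'⟩, hq'⟩ _ e
    obtain ⟨e1, e2⟩ := Prod.mk.inj e
    exact Subtype.ext (Prod.ext (Fin.ext e1) (Fin.ext e2))
  · rintro ⟨i, j⟩ hq
    obtain ⟨h1, h2⟩ := mem_pairList.mp (List.mem_toFinset.mp hq)
    exact ⟨⟨(⟨i, h1.trans h2⟩, ⟨j, h2⟩), h1⟩, Finset.mem_univ _, rfl⟩
  · intro q _
    rfl

instance : Fact (Nat.Prime 13) := ⟨by norm_num⟩

/-- Fermat's little theorem; at 0 both sides take the value 0. -/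
lemma pow_eleven_eq_inverse (x : ZMod 13) : x ^ 11 = Ring.inverse x := by
  rw [Ring.inverse_eq_inv']
  rcases eq_or_ne x 0 with rfl | hx
  · simp
  · exact eq_inv_of_mul_eq_one_left (by rw [← pow_succ]; exact ZMod.pow_card_sub_one_eq_one hx)

lemma twelve_eq_neg_one : (12 : ZMod 13) = -1 := by decide

lemma natCast_sampleSign (j : Fin 2) (i : Fin n) :
    (sampleSign k j i : ZMod 13) = compSign (ZMod 13) k j i := by
  unfold sampleSign compSign
  have hj : (j : ℕ) = 0 ↔ j = 0 := by rw [Fin.ext_iff]; rfl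
  simp only [hj]
  split_ifs <;> simp [twelve_eq_neg_one]

lemma natCast_sampleJetOne (j : Fin 2) (h i : Fin n) :
    (sampleJetOne k j h i : ZMod 13) = jetOne k (sampleNodes n) j h i := by
  rw [sampleJetOne, jetOne]
  push_cast
  rw [natCast_sampleSign]
  simp only [← pow_eleven_eq_inverse, sampleNodes, Fin.val_inj, twelve_eq_neg_one]
  ring_nf

lemma natCast_sampleJetTwo (j : Fin 2) (h i : Fin n) :
    (sampleJetTwo k j h i : ZMod 13) = jetTwo k (sampleNodes n) j h i := by
  rw [sampleJetTwo, jetTwo]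
  push_cast
  rw [natCast_sampleSign]
  simp only [← pow_eleven_eq_inverse, sampleNodes, Fin.val_inj, twelve_eq_neg_one, ← pow_mul]
  ring_nf

lemma separated_sampleNodes (hn : n < 12) : Separated (sampleNodes n) := by
  -- The powers 2 ^ i with i < 11 are distinct modulo 13 because 2 is a primitive root.
  have h0 : ∀ j < 2, ∀ i < 11, (sampleNode j i : ZMod 13) ≠ 0 := by decide
  have h1 : ∀ j < 2, ∀ h < 11, ∀ i < 11, h ≠ i →
      (sampleNode j h : ZMod 13) - (sampleNode j i : ZMod 13) ≠ 0 := by decide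
  refine fun j => ⟨fun i => (h0 j j.isLt i (by omega)).isUnit, fun h i hi => ?_⟩
  exact (h1 j j.isLt h (by omega) i (by omega) (Fin.val_injective.ne hi)).isUnit

lemma eq_zero_of_sample (hn : n < 12) (x : Pair n → ZMod 13)
    (hx : (conditionMatrix ((n + 1) / 2) (sampleNodes n)).mulVec x = 0) : x = 0 := by
  set k := (n + 1) / 2 with hk
  -- The unknowns are extended by zero to all pairs of natural numbers, the index type of the
  -- computation.
  let X : ℕ × ℕ → ZMod 13 := fun q => if h : q.1 < q.2 ∧ q.2 < n then
    x ⟨(⟨q.1, h.1.trans h.2⟩, ⟨q.2, h.2⟩), h.1⟩ else 0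
  have hX : ∀ q : Pair n, X (q.1.1, q.1.2) = x q := fun q => dif_pos ⟨q.2, q.1.2.isLt⟩
  have hE : ∀ (c : Condition n) (u v : ℕ → ℕ),
      (∀ i : Fin n, (u i : ZMod 13) = (conditionForms k (sampleNodes n) c).1 i) →
      (∀ i : Fin n, (v i : ZMod 13) = (conditionForms k (sampleNodes n) c).2 i) →
      ((pairList n).map fun q => (sampleWedge u v q : ZMod 13) * X q).sum = 0 := by
    intro c u v hu hv
    rw [sum_pairList]
    refine Eq.trans ?_ (congrFun hx c)
    refine Finset.sum_congr rfl fun q _ => ?_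
    rw [hX, sampleWedge]
    push_cast
    rw [hu, hu, hv, hv, twelve_eq_neg_one, conditionMatrix, Matrix.of_apply]
    ring
  have hs : ∀ h i : Fin n, (((if (i : ℕ) = h then 1 else 0 : ℕ)) : ZMod 13) =
      Pi.single (M := fun _ => ZMod 13) h 1 i := by
    intro h i
    simp only [Pi.single_apply, Fin.val_inj]
    split_ifs <;> simp
  have key := eq_zero_of_eliminate_map (p := 13) (B := 2 ^ 300) (pairList n) (sampleEquations n k) X
    ?_ ?_ (eliminate_sampleEquations n hn)
  · funext q
    rw [← hX]
    exact key _ (mem_pairList.mpr ⟨q.2, q.1.2.isLt⟩)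
  · have : ∀ n < 12, 13 * (2 * 13) ^ (pairList n).length ≤ 2 ^ 300 := by decide +kernel
    exact this n hn
  · intro e he
    rcases List.mem_append.mp he with he | he
    · obtain ⟨h, hh, he⟩ := List.mem_flatMap.mp he
      have hh := List.mem_range.mp hh
      simp only [List.mem_cons, List.not_mem_nil, or_false] at he
      rcases he with rfl | rfl | rfl | rfl | rfl
      · exact hE (Sum.inl (⟨h, hh⟩, 0)) _ _ (hs ⟨h, hh⟩) (natCast_sampleJetOne k 0 ⟨h, hh⟩)
      · exact hE (Sum.inl (⟨h, hh⟩, 1)) _ _ (hs ⟨h, hh⟩) (natCast_sampleJetTwo k 0 ⟨h, hh⟩)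
      · exact hE (Sum.inl (⟨h, hh⟩, 2)) _ _ (hs ⟨h, hh⟩) (natCast_sampleJetOne k 1 ⟨h, hh⟩)
      · exact hE (Sum.inl (⟨h, hh⟩, 3)) _ _ (hs ⟨h, hh⟩) (natCast_sampleJetTwo k 1 ⟨h, hh⟩)
      · exact hE (Sum.inl (⟨h, hh⟩, 4)) _ _ (natCast_sampleJetOne k 0 ⟨h, hh⟩)
          (natCast_sampleJetOne k 1 ⟨h, hh⟩)
    · simp only [List.mem_cons, List.not_mem_nil, or_false] at he
      have h0 := natCast_sampleSign (n := n) k 0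
      have h1 := natCast_sampleSign (n := n) k 1
      rcases he with rfl | rfl
      · refine hE (Sum.inr 0) _ _ (fun i => ?_) (fun i => ?_)
        · rw [Nat.cast_mul]; exact congrArg (· * _) (h0 i)
        · rw [Nat.cast_mul]; exact congrArg (· * _) (h1 i)
      · refine hE (Sum.inr 1) _ _ (fun i => ?_) (fun i => ?_)
        · rw [Nat.cast_mul, Nat.cast_pow, pow_eleven_eq_inverse]; exact congrArg (· * _) (h0 i)
        · rw [Nat.cast_mul, Nat.cast_pow, pow_eleven_eq_inverse]; exact congrArg (· * _) (h1 i)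

end Sample

/-! ### Injectivity for general nodes -/

section Generic

variable {n : ℕ}

/-- The polynomial that vanishes where the nodes on a component are not distinct or not nonzero. -/
def separatingPoly (n : ℕ) : MvPolynomial (Fin 2 × Fin n) ℤ :=
  ∏ j, ((∏ i, MvPolynomial.X (j, i)) *
    ∏ q : {q : Fin n × Fin n // q.1 ≠ q.2}, (MvPolynomial.X (j, q.1.1) - MvPolynomial.X (j, q.1.2)))

lemma isUnit_map_separatingPoly {S : Type*} [CommRing S]
    (φ : MvPolynomial (Fin 2 × Fin n) ℤ →+* S) :
    IsUnit (φ (separatingPoly n)) ↔ Separated fun q => φ (MvPolynomial.X q) := by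
  simp only [separatingPoly, map_prod, map_mul, map_sub, IsUnit.prod_iff, IsUnit.mul_iff,
    Separated, Finset.mem_univ, true_imp_iff, Subtype.forall, Prod.forall]

/-- The condition matrix is injective for general nodes. -/
lemma exists_polynomial_conditionMatrix (hn : n < 12) :
    ∃ F : MvPolynomial (Fin 2 × Fin n) ℂ, F ≠ 0 ∧ ∀ a, MvPolynomial.eval a F ≠ 0 →
      Separated a ∧ ∀ x, (conditionMatrix ((n + 1) / 2) a).mulVec x = 0 → x = 0 := by
  set k := (n + 1) / 2 with hk
  let D := separatingPoly n
  let A := Localization.Away D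
  let ι : MvPolynomial (Fin 2 × Fin n) ℤ →+* A := algebraMap _ A
  let X : Fin 2 × Fin n → A := fun q => ι (MvPolynomial.X q)
  have hX : Separated X :=
    (isUnit_map_separatingPoly ι).mp (IsLocalization.Away.algebraMap_isUnit D)
  -- a left inverse modulo `13`, lifted to the integers
  have hinj : Function.Injective (Matrix.toLin' (conditionMatrix k (sampleNodes n))) := by
    rw [injective_iff_map_eq_zero]
    exact fun x hx => eq_zero_of_sample hn x hx
  obtain ⟨f, hf⟩ := LinearMap.exists_leftInverse_of_injective _ (LinearMap.ker_eq_bot.mpr hinj)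
  obtain ⟨N, hN⟩ : ∃ N : Matrix (Pair n) (Condition n) ℤ,
      N.map (Int.castRingHom (ZMod 13)) = LinearMap.toMatrix' f := by
    choose s hs using ZMod.intCast_surjective (n := 13)
    exact ⟨(LinearMap.toMatrix' f).map s, by ext; simp [hs]⟩
  have hleft : N.map (Int.castRingHom (ZMod 13)) * conditionMatrix k (sampleNodes n) = 1 := by
    rw [hN, ← LinearMap.toMatrix'_toLin' (conditionMatrix k (sampleNodes n)),
      ← LinearMap.toMatrix'_comp, hf, LinearMap.toMatrix'_id]
  -- A square determinant over the universal ring of separated nodes; it specializes to 1 at the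
  -- sample nodes modulo 13.
  let δ : A := (N.map (Int.castRingHom A) * conditionMatrix k X).det
  -- specialization of the nodes
  have hspec : ∀ {F : Type} [Field F] (a : Fin 2 × Fin n → F), Separated a →
      ∃ φ : A →+* F, (∀ P, φ (ι P) = MvPolynomial.eval₂ (Int.castRingHom F) a P) ∧
        φ δ = (N.map (Int.castRingHom F) * conditionMatrix k a).det := by
    intro F _ a ha
    let ψ := MvPolynomial.eval₂Hom (Int.castRingHom F) a
    have hψX : (fun q => ψ (MvPolynomial.X q)) = a := by
      funext q; exact MvPolynomial.eval₂_X _ _ _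
    have hψ : IsUnit (ψ D) := (isUnit_map_separatingPoly ψ).mpr (by rw [hψX]; exact ha)
    let φ : A →+* F := IsLocalization.Away.lift D hψ
    have hφ : ∀ P, φ (ι P) = ψ P := IsLocalization.Away.lift_eq D hψ
    have hφX : φ ∘ X = a := by
      rw [← hψX]; funext q; exact hφ _
    refine ⟨φ, hφ, ?_⟩
    change φ (Matrix.det _) = _
    rw [RingHom.map_det, RingHom.mapMatrix_apply, Matrix.map_mul, map_conditionMatrix φ hX, hφX,
      Matrix.map_map]
    congr 3
    ext; simp
  -- Clearing denominators, δ D ^ m = P with P an integer polynomial. The extra factor D in P * D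
  -- makes the nodes separated wherever the product does not vanish.
  obtain ⟨m, P, hP⟩ := IsLocalization.Away.surj D δ
  refine ⟨MvPolynomial.map (Int.castRingHom ℂ) (P * D), ?_, ?_⟩
  · intro h0
    have h1 : P * D = 0 := MvPolynomial.map_injective _ Int.cast_injective (by rw [h0, map_zero])
    obtain ⟨φ, hφ, hδ⟩ := hspec _ (separated_sampleNodes hn)
    rw [hleft, Matrix.det_one] at hδ
    have hDu : IsUnit (φ (ι D)) := (IsLocalization.Away.algebraMap_isUnit D).map φ
    have h2 := congrArg φ hP
    rw [map_mul, hδ, one_mul, map_pow] at h2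
    have h3 : φ (ι P) * φ (ι D) = 0 := by rw [← map_mul, ← map_mul, h1, map_zero, map_zero]
    rw [← h2] at h3
    exact (mul_ne_zero (pow_ne_zero _ hDu.ne_zero) hDu.ne_zero) h3
  · intro a ha
    rw [MvPolynomial.eval_map, MvPolynomial.eval₂_mul] at ha
    have hD : MvPolynomial.eval₂ (Int.castRingHom ℂ) a D ≠ 0 := right_ne_zero_of_mul ha
    have hPa := left_ne_zero_of_mul ha
    have hsep : Separated a := by
      have := (isUnit_map_separatingPoly
        (MvPolynomial.eval₂Hom (Int.castRingHom ℂ) a)).mp hD.isUnit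
      simpa using this
    refine ⟨hsep, fun x hx => ?_⟩
    obtain ⟨φ, hφ, hδ⟩ := hspec a hsep
    have h2 := congrArg φ hP
    rw [map_mul, hδ, hφ] at h2
    rw [← h2] at hPa
    -- The determinant of N M does not vanish at a, so N M is injective, and therefore M is.
    refine Matrix.eq_zero_of_mulVec_eq_zero (left_ne_zero_of_mul hPa) ?_
    rw [← Matrix.mulVec_mulVec, hx, Matrix.mulVec_zero]

end Generic

/-! ### Linear forms on Kähler differentials and on exterior squares -/

section Forms

variable {V S : Type} [AddCommGroup V] [Module ℂ V] [CommRing S] [Algebra ℂ S]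

/-- A bilinear form `β` with `β f (g h) = β (f g) h + β (f h) g` defines a linear form
`f dg ↦ β f g` on the Kähler differentials. -/
lemma exists_linearForm_kaehler (β : S →ₗ[ℂ] S →ₗ[ℂ] ℂ)
    (hβ : ∀ f g h, β f (g * h) = β (f * g) h + β (f * h) g) :
    ∃ T : Ω[S⁄ℂ] →ₗ[ℂ] ℂ, ∀ f g, T (f • KaehlerDifferential.D ℂ S g) = β f g := by
  -- The ℂ-dual of S is an S-module by (s φ)(x) = φ(s x). The condition on β says that g ↦ β(·, g)
  -- is a derivation into it; the linear form is its lift to Ω followed by evaluation at 1.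
  let _ : Module S (S →ₗ[ℂ] ℂ) :=
    { smul := fun s φ => φ ∘ₗ LinearMap.mulLeft ℂ s
      one_smul := fun φ => LinearMap.ext fun x => congrArg φ (one_mul x)
      mul_smul := fun s t φ => LinearMap.ext fun x => congrArg φ (by
        simp only [LinearMap.mulLeft_apply]; ring)
      smul_zero := fun s => rfl
      smul_add := fun s φ ψ => rfl
      add_smul := fun s t φ => LinearMap.ext fun x => by
        change φ ((s + t) * x) = φ (s * x) + φ (t * x)
        rw [add_mul, map_add]
      zero_smul := fun φ => LinearMap.ext fun x => by
        change φ (0 * x) = 0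
        rw [zero_mul, map_zero] }
  have smul_def : ∀ (s : S) (φ : S →ₗ[ℂ] ℂ) (x : S), (s • φ) x = φ (s * x) := fun _ _ _ => rfl
  have : IsScalarTower ℂ S (S →ₗ[ℂ] ℂ) := ⟨fun z s φ => LinearMap.ext fun x => by
    rw [LinearMap.smul_apply, smul_def, smul_def, smul_mul_assoc, map_smul]⟩
  let d : Derivation ℂ S (S →ₗ[ℂ] ℂ) := Derivation.mk' β.flip fun g h => LinearMap.ext fun f => by
    rw [LinearMap.add_apply, smul_def, smul_def, LinearMap.flip_apply, LinearMap.flip_apply,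
      LinearMap.flip_apply, hβ, mul_comm f g, mul_comm f h]
  refine ⟨LinearMap.applyₗ (1 : S) ∘ₗ d.liftKaehlerDifferential.restrictScalars ℂ, fun f g => ?_⟩
  simp only [LinearMap.comp_apply, LinearMap.restrictScalars_apply, map_smul,
    Derivation.liftKaehlerDifferential_comp_D, LinearMap.applyₗ_apply_apply, smul_def, mul_one]
  rfl

/-- The linear form on the exterior square defined by two linear forms. -/
def wedge (u v : V →ₗ[ℂ] ℂ) : ⋀[ℂ]^2 V →ₗ[ℂ] ℂ :=
  exteriorPower.pairingDual ℂ V 2 (exteriorPower.ιMulti ℂ 2 ![u, v])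

lemma wedge_ιMulti (u v : V →ₗ[ℂ] ℂ) (w : Fin 2 → V) :
    wedge u v (exteriorPower.ιMulti ℂ 2 w) = u (w 0) * v (w 1) - v (w 0) * u (w 1) := by
  rw [wedge, exteriorPower.pairingDual_ιMulti_ιMulti, Matrix.det_fin_two]
  rfl

/-- A linear form of the differential `f₁ df₂ - f₂ df₁` that is a multiple of `u ∧ v`. -/
lemma wedge_eq_zero_of_localGaussian (coeff : V →ₗ[ℂ] S) (β : S →ₗ[ℂ] S →ₗ[ℂ] ℂ)
    (hβ : ∀ f g h, β f (g * h) = β (f * g) h + β (f * h) g) (u v : V →ₗ[ℂ] ℂ) {z : ℂ} (hz : z ≠ 0)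
    (huv : ∀ σ τ, β (coeff σ) (coeff τ) - β (coeff τ) (coeff σ) = z * (u σ * v τ - v σ * u τ))
    {x : ⋀[ℂ]^2 V} (hx : localGaussian coeff x = 0) : wedge u v x = 0 := by
  obtain ⟨T, hT⟩ := exists_linearForm_kaehler β hβ
  have h : T ∘ₗ localGaussian coeff = z • wedge u v := by
    apply exteriorPower.linearMap_ext
    ext w
    simp only [LinearMap.compAlternatingMap_apply, LinearMap.comp_apply, LinearMap.smul_apply,
      localGaussian, exteriorPower.alternatingMapLinearEquiv_apply_ιMulti, wedge_ιMulti]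
    simp only [wronskian, AlternatingMap.coe_mk, MultilinearMap.coe_mk, map_sub, hT, huv,
      smul_eq_mul]
  have := LinearMap.congr_fun h x
  rw [LinearMap.comp_apply, hx, map_zero, LinearMap.smul_apply, smul_eq_mul] at this
  exact (mul_eq_zero.mp this.symm).resolve_left hz

/-- The Cauchy–Binet formula for 2 × 2 minors. -/
lemma sum_mul_sum_sub_sum_mul_sum {n : ℕ} (u v s t : Fin n → ℂ) :
    (∑ i, u i * s i) * (∑ i, v i * t i) - (∑ i, v i * s i) * (∑ i, u i * t i) =
      ∑ q : Pair n, (u q.1.1 * v q.1.2 - u q.1.2 * v q.1.1) *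
        (s q.1.1 * t q.1.2 - s q.1.2 * t q.1.1) := by
  have h1 : (∑ i, u i * s i) * (∑ i, v i * t i) - (∑ i, v i * s i) * (∑ i, u i * t i) =
      ∑ q : Fin n × Fin n, (u q.1 * v q.2 - u q.2 * v q.1) * (s q.1 * t q.2) := by
    rw [Finset.sum_mul_sum, Finset.sum_mul_sum, ← Finset.sum_sub_distrib, Fintype.sum_prod_type]
    refine Finset.sum_congr rfl fun i _ => ?_
    rw [← Finset.sum_sub_distrib]
    exact Finset.sum_congr rfl fun j _ => by ring
  set f : Fin n × Fin n → ℂ := fun q => (u q.1 * v q.2 - u q.2 * v q.1) * (s q.1 * t q.2) with hf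
  -- The terms with i > j are folded onto i < j by the swap; the diagonal terms vanish.
  have h2 : ∑ q, f q = ∑ q ∈ Finset.univ.filter (fun q : Fin n × Fin n => q.1 < q.2), f q +
      ∑ q ∈ Finset.univ.filter (fun q : Fin n × Fin n => q.1 < q.2), f q.swap := by
    rw [← Finset.sum_filter_add_sum_filter_not Finset.univ (fun q : Fin n × Fin n => q.1 < q.2)]
    congr 1
    rw [← Finset.sum_filter_add_sum_filter_not _ (fun q : Fin n × Fin n => q.2 < q.1),
      add_comm, Finset.sum_eq_zero (s := Finset.filter _ (Finset.filter _ _)), zero_add]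
    swap
    · intro q hq
      simp only [Finset.mem_filter, Finset.mem_univ, true_and, not_lt] at hq
      rw [hf]
      simp only [le_antisymm hq.1 hq.2]
      ring
    refine Finset.sum_bij' (fun q _ => q.swap) (fun q _ => q.swap) ?_ ?_ ?_ ?_ ?_
    · intro q hq
      simp only [Finset.mem_filter, Finset.mem_univ, true_and, not_lt] at hq ⊢
      exact hq.2
    · intro q hq
      simp only [Finset.mem_filter, Finset.mem_univ, true_and, not_lt] at hq ⊢
      exact ⟨hq.le, hq⟩
    · intro q _; exact Prod.swap_swap q
    · intro q _; exact Prod.swap_swap q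
    · intro q _; rw [Prod.swap_swap]
  rw [h1, h2, ← Finset.sum_add_distrib,
    Finset.sum_subtype (p := fun q : Fin n × Fin n => q.1 < q.2) _ (by simp)]
  refine Finset.sum_congr rfl fun q _ => ?_
  simp only [hf, Prod.fst_swap, Prod.snd_swap]
  ring

/-- The expansion of `u ∧ v` in coordinates. -/
lemma wedge_eq_sum {n : ℕ} (r : Fin n → V →ₗ[ℂ] ℂ) (u v : Fin n → ℂ) (x : ⋀[ℂ]^2 V) :
    wedge (∑ i, u i • r i) (∑ i, v i • r i) x =
      ∑ q : Pair n, (u q.1.1 * v q.1.2 - u q.1.2 * v q.1.1) * wedge (r q.1.1) (r q.1.2) x := by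
  have h : wedge (∑ i, u i • r i) (∑ i, v i • r i) =
      ∑ q : Pair n, (u q.1.1 * v q.1.2 - u q.1.2 * v q.1.1) • wedge (r q.1.1) (r q.1.2) := by
    apply exteriorPower.linearMap_ext
    ext w
    simp only [LinearMap.compAlternatingMap_apply, LinearMap.sum_apply, LinearMap.smul_apply,
      wedge_ιMulti, smul_eq_mul]
    exact sum_mul_sum_sub_sum_mul_sum _ _ _ _
  rw [h, LinearMap.sum_apply]
  rfl

/-- If the linear forms `r i` separate the points, then the forms `r i ∧ r j` do so. -/
lemma eq_zero_of_wedge_eq_zero {n : ℕ} (r : Fin n → V →ₗ[ℂ] ℂ)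
    (hr : ∀ σ, (∀ i, r i σ = 0) → σ = 0) (x : ⋀[ℂ]^2 V)
    (hx : ∀ q : Pair n, wedge (r q.1.1) (r q.1.2) x = 0) : x = 0 := by
  -- The forms r embed V into ℂⁿ. Over a field the exterior square of this embedding stays
  -- injective, and in the standard basis its coordinates are the r i ∧ r j.
  have hinj : Function.Injective (LinearMap.pi r) := by
    rw [injective_iff_map_eq_zero]
    exact fun σ hσ => hr σ fun i => congrFun hσ i
  refine (map_eq_zero_iff _ (exteriorPower.map_injective_field (n := 2) hinj)).mp ?_
  refine ((Pi.basisFun ℂ (Fin n)).exteriorPower 2).repr.map_eq_zero_iff.mp (Finsupp.ext fun s => ?_)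
  rw [exteriorPower.basis_repr_apply]
  let o := Set.powersetCard.ofFinEmbEquiv.symm s
  have h : exteriorPower.ιMultiDual ℂ 2 (Pi.basisFun ℂ (Fin n)) s ∘ₗ
      exteriorPower.map 2 (LinearMap.pi r) = wedge (r (o 0)) (r (o 1)) := by
    apply exteriorPower.linearMap_ext
    ext w
    simp only [LinearMap.compAlternatingMap_apply, LinearMap.comp_apply, wedge_ιMulti,
      exteriorPower.map_apply_ιMulti, exteriorPower.ιMultiDual_apply_ιMulti, Matrix.det_fin_two]
    simp [o]
  exact (LinearMap.congr_fun h x).trans (hx ⟨(o 0, o 1), o.strictMono Fin.zero_lt_one⟩)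

end Forms

/-! ### Taylor expansions on the projective line -/

section Taylor

open Polynomial

/-- The parameter is transcendental over ℂ, since t is algebraic over the field that it generates.
-/
lemma aeval_param_injective (p : P1) : Function.Injective (aeval (R := ℂ) (param p)) := by
  rw [← transcendental_iff_injective]
  have hX : Transcendental ℂ (RatFunc.X : K) := by
    rw [transcendental_iff_injective]
    intro P Q h
    apply RatFunc.algebraMap_injective ℂ
    have : ∀ P : ℂ[X], aeval (RatFunc.X : K) P = algebraMap ℂ[X] K P := by
      intro P
      rw [← RatFunc.algebraMap_X, aeval_algebraMap_apply, aeval_X_left_apply]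
    rw [← this, ← this, h]
  intro h
  apply hX
  induction p using OnePoint.rec with
  | infty => exact IsAlgebraic.inv_iff.mp h
  | coe a =>
    have h2 : IsAlgebraic ℂ (RatFunc.C a : K) := isAlgebraic_algebraMap a
    have h3 : (RatFunc.X : K) = param (a : P1) + RatFunc.C a := (sub_add_cancel _ _).symm
    rw [h3]
    exact h.add h2

/-- The power series `F` is the expansion of the rational function `f` in the local parameter at
`p`. -/
def HasTaylor (p : P1) (f : K) (F : PowerSeries ℂ) : Prop :=
  ∃ A B : ℂ[X], B.eval 0 ≠ 0 ∧ f * aeval (param p) B = aeval (param p) A ∧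
    F * (B : PowerSeries ℂ) = A

variable {p : P1} {f g : K} {F G : PowerSeries ℂ}

lemma ne_zero_of_eval_ne_zero {B : ℂ[X]} (hB : B.eval 0 ≠ 0) : B ≠ 0 := by
  rintro rfl
  simp at hB

namespace HasTaylor

/-- By transcendence of the parameter, two fractions A / B and A' / B' for the same function satisfy
A B' = A' B as polynomials, hence as power series. -/
lemma unique (h : HasTaylor p f F) (h' : HasTaylor p f G) : F = G := by
  obtain ⟨A, B, hB, e, E⟩ := h
  obtain ⟨A', B', hB', e', E'⟩ := h'
  have h1 : A * B' = A' * B := by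
    apply aeval_param_injective p
    rw [map_mul, map_mul, ← e, ← e']
    ring
  have h2 : (A : PowerSeries ℂ) * B' = A' * B := by
    rw [← Polynomial.coe_mul, h1, Polynomial.coe_mul]
  have h3 : ((B * B' : ℂ[X]) : PowerSeries ℂ) ≠ 0 := by
    rw [Ne, Polynomial.coe_eq_zero_iff]
    exact mul_ne_zero (ne_zero_of_eval_ne_zero hB) (ne_zero_of_eval_ne_zero hB')
  apply mul_right_cancel₀ h3
  rw [Polynomial.coe_mul]
  linear_combination (B' : PowerSeries ℂ) * E - (B : PowerSeries ℂ) * E' + h2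

lemma add (h : HasTaylor p f F) (h' : HasTaylor p g G) : HasTaylor p (f + g) (F + G) := by
  obtain ⟨A, B, hB, e, E⟩ := h
  obtain ⟨A', B', hB', e', E'⟩ := h'
  refine ⟨A * B' + A' * B, B * B', by simpa using ⟨hB, hB'⟩, ?_, ?_⟩
  · rw [map_add, map_mul, map_mul, map_mul, ← e, ← e']
    ring
  · rw [Polynomial.coe_add, Polynomial.coe_mul, Polynomial.coe_mul, Polynomial.coe_mul, ← E, ← E']
    ring

lemma mul (h : HasTaylor p f F) (h' : HasTaylor p g G) : HasTaylor p (f * g) (F * G) := by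
  obtain ⟨A, B, hB, e, E⟩ := h
  obtain ⟨A', B', hB', e', E'⟩ := h'
  refine ⟨A * A', B * B', by simpa using ⟨hB, hB'⟩, ?_, ?_⟩
  · rw [map_mul, map_mul, ← e, ← e']
    ring
  · rw [Polynomial.coe_mul, Polynomial.coe_mul, ← E, ← E']
    ring

lemma aeval (A : ℂ[X]) : HasTaylor p (aeval (param p) A) A :=
  ⟨A, 1, by simp, by simp, by simp⟩

lemma const (c : ℂ) : HasTaylor p (algebraMap ℂ K c) (PowerSeries.C c) := by
  simpa using HasTaylor.aeval (p := p) (C c)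

lemma zero : HasTaylor p 0 0 := by
  simpa using const (p := p) 0

lemma one : HasTaylor p 1 1 := by
  simpa using const (p := p) 1

lemma param : HasTaylor p (param p) PowerSeries.X := by
  simpa using HasTaylor.aeval (p := p) X

lemma sub (h : HasTaylor p f F) (h' : HasTaylor p g G) : HasTaylor p (f - g) (F - G) := by
  have := h.add ((const (-1)).mul h')
  simpa [sub_eq_add_neg] using this

lemma inv (h : HasTaylor p f F) (hF : PowerSeries.constantCoeff F ≠ 0) : HasTaylor p f⁻¹ F⁻¹ := by
  obtain ⟨A, B, hB, e, E⟩ := h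
  have hA : A.eval 0 ≠ 0 := by
    have := congrArg PowerSeries.constantCoeff E
    rw [map_mul, Polynomial.constantCoeff_coe, Polynomial.constantCoeff_coe,
      coeff_zero_eq_eval_zero, coeff_zero_eq_eval_zero] at this
    rw [← this]
    exact mul_ne_zero hF hB
  have hf : f ≠ 0 := by
    rintro rfl
    rw [zero_mul, ← map_zero (Polynomial.aeval (R := ℂ) (PrymBinary.param p))] at e
    exact ne_zero_of_eval_ne_zero hA (aeval_param_injective p e).symm
  refine ⟨B, A, hA, ?_, ?_⟩
  · rw [← e, inv_mul_cancel_left₀ hf]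
  · rw [← E, ← mul_assoc, PowerSeries.inv_mul_cancel _ hF, one_mul]

lemma sum {ι : Type*} (s : Finset ι) (f : ι → K) (F : ι → PowerSeries ℂ)
    (h : ∀ i ∈ s, HasTaylor p (f i) (F i)) : HasTaylor p (∑ i ∈ s, f i) (∑ i ∈ s, F i) := by
  classical
  induction s using Finset.induction_on with
  | empty => simpa using zero
  | insert i s hi ih =>
    rw [Finset.sum_insert hi, Finset.sum_insert hi]
    exact (h i (Finset.mem_insert_self _ _)).add
      (ih fun j hj => h j (Finset.mem_insert_of_mem hj))

lemma mem (h : HasTaylor p f F) : f ∈ localRing p := by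
  obtain ⟨A, B, hB, e, -⟩ := h
  exact ⟨A, B, hB, e⟩

end HasTaylor

lemma exists_hasTaylor (hf : f ∈ localRing p) : ∃ F, HasTaylor p f F := by
  obtain ⟨A, B, hB, e⟩ := hf
  refine ⟨A * (B : PowerSeries ℂ)⁻¹, A, B, hB, e, ?_⟩
  rw [mul_assoc, PowerSeries.inv_mul_cancel, mul_one]
  rwa [Polynomial.constantCoeff_coe, coeff_zero_eq_eval_zero]

/-- The Taylor expansion at `p`, in the local parameter. -/
def taylor (p : P1) : localRing p →ₐ[ℂ] PowerSeries ℂ :=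
  -- The chosen expansions form an algebra homomorphism because expansions are unique.
  have spec : ∀ f : localRing p, HasTaylor p f (exists_hasTaylor f.2).choose :=
    fun f => (exists_hasTaylor f.2).choose_spec
  { toFun := fun f => (exists_hasTaylor f.2).choose
    map_one' := (spec 1).unique HasTaylor.one
    map_mul' := fun f g => (spec (f * g)).unique ((spec f).mul (spec g))
    map_zero' := (spec 0).unique HasTaylor.zero
    map_add' := fun f g => (spec (f + g)).unique ((spec f).add (spec g))
    commutes' := fun c => (spec (algebraMap ℂ _ c)).unique (HasTaylor.const c) }

lemma hasTaylor_taylor (f : localRing p) : HasTaylor p f (taylor p f) :=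
  (exists_hasTaylor f.2).choose_spec

/-- A rational function without poles in `ℂ` is a polynomial. -/
lemma exists_polynomial_of_mem_localRing (hf : ∀ b : ℂ, f ∈ localRing (b : P1)) :
    ∃ P : ℂ[X], f = algebraMap ℂ[X] K P := by
  have haeval : ∀ (b : ℂ) (P : ℂ[X]), aeval (param (b : P1)) P =
      algebraMap ℂ[X] K (P.comp (X - C b)) := by
    intro b P
    have h1 : param (b : P1) = algebraMap ℂ[X] K (X - C b) := by
      rw [map_sub, RatFunc.algebraMap_X, RatFunc.algebraMap_C]
      rfl
    rw [h1, aeval_algebraMap_apply, comp_eq_aeval]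
  -- At a root b of the denominator, regularity forces the numerator to vanish as well, against
  -- coprimality.
  have hdeg : f.denom.natDegree = 0 := by
    by_contra h
    obtain ⟨b, hb⟩ := Complex.exists_root (natDegree_pos_iff_degree_pos.mp (Nat.pos_of_ne_zero h))
    obtain ⟨A, B, hB, e⟩ := hf b
    have h1 : f.num * B.comp (X - C b) = A.comp (X - C b) * f.denom := by
      apply RatFunc.algebraMap_injective ℂ
      rw [map_mul, map_mul, ← haeval, ← haeval, ← e]
      have h2 : algebraMap ℂ[X] K f.denom ≠ 0 := RatFunc.algebraMap_ne_zero f.denom_ne_zero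
      have h3 : algebraMap ℂ[X] K f.num = f * algebraMap ℂ[X] K f.denom := by
        rw [← div_eq_iff h2]
        exact RatFunc.num_div_denom f
      rw [h3]
      ring
    have h4 := congrArg (eval b) h1
    rw [eval_mul, eval_mul, hb.eq_zero, mul_zero, eval_comp, eval_sub, eval_X, eval_C, sub_self]
      at h4
    have h5 : eval b f.num = 0 := (mul_eq_zero.mp h4).resolve_right hB
    obtain ⟨U, W, hUW⟩ := RatFunc.isCoprime_num_denom f
    have h6 := congrArg (eval b) hUW
    rw [eval_add, eval_mul, eval_mul, h5, hb.eq_zero] at h6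
    simp at h6
  have h1 : f.denom = 1 := (RatFunc.monic_denom f).natDegree_eq_zero.mp hdeg
  refine ⟨f.num, ?_⟩
  conv_lhs => rw [← RatFunc.num_div_denom f]
  rw [h1, map_one, div_one]

/-- A polynomial that vanishes at `∞` is zero. -/
lemma eq_zero_of_hasTaylor_infty {P : ℂ[X]}
    (h : HasTaylor OnePoint.infty (RatFunc.X * algebraMap ℂ[X] K P) F) : P = 0 := by
  by_contra hP
  have hX : (RatFunc.X : K) ≠ 0 := RatFunc.X_ne_zero
  have hu : param OnePoint.infty = (RatFunc.X : K)⁻¹ := rfl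
  let _ : Invertible (RatFunc.X : K) := invertibleOfNonzero hX
  have h1 : aeval (param OnePoint.infty) P.reverse * RatFunc.X ^ P.natDegree =
      algebraMap ℂ[X] K P := by
    have := eval₂_reverse_mul_pow (algebraMap ℂ K) (RatFunc.X : K) P
    rw [invOf_eq_inv] at this
    rw [hu, aeval_def, this, ← aeval_def, ← RatFunc.algebraMap_X, aeval_algebraMap_apply,
      aeval_X_left_apply]
  -- With u = 1/t and d the degree of P, the reversed polynomial at u is u ^ d P(t) = u ^ (d + 1) (t
  -- P(t)). Its constant term is the leading coefficient of P, yet it is divisible by u.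
  have h2 : HasTaylor OnePoint.infty (aeval (param OnePoint.infty) P.reverse)
      (PowerSeries.X ^ (P.natDegree + 1) * F) := by
    have hpow : ∀ m : ℕ, HasTaylor OnePoint.infty ((RatFunc.X : K)⁻¹ ^ m) (PowerSeries.X ^ m) := by
      intro m
      simpa [hu] using HasTaylor.aeval (p := OnePoint.infty) ((X : ℂ[X]) ^ m)
    have h3 := (hpow (P.natDegree + 1)).mul h
    rwa [← h1, pow_succ, mul_assoc, inv_mul_cancel_left₀ hX, mul_comm (aeval _ _) _, ← mul_assoc,
      inv_pow, inv_mul_cancel₀ (pow_ne_zero _ hX), one_mul] at h3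
  have h4 := congrArg PowerSeries.constantCoeff (h2.unique (HasTaylor.aeval P.reverse))
  rw [Polynomial.constantCoeff_coe, coeff_zero_reverse] at h4
  simp only [map_mul, map_pow, PowerSeries.constantCoeff_X, pow_succ, mul_zero, zero_mul] at h4
  exact hP (leadingCoeff_eq_zero.mp h4.symm)

end Taylor

/-! ### Jets of sections at the nodes -/

namespace BinaryCurve

variable {N : Type} (C : BinaryCurve N)

lemma branch_mem (h : N) (j : Fin 2) (f : C.nodeRing h) :
    C.branch h j f ∈ localRing (C.node j h) := by
  obtain ⟨c, hc⟩ := f.2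
  obtain ⟨ρ, hρ, e⟩ := hc j
  change f.1 j ∈ _
  rw [e]
  exact add_mem (algebraMap_mem _ c) (mul_mem (param_mem _) hρ)

/-- The Taylor expansion on the `j`-th branch at the node `h`. -/
def nodeTaylor (h : N) (j : Fin 2) : C.nodeRing h →ₐ[ℂ] PowerSeries ℂ :=
  (taylor (C.node j h)).comp ((C.branch h j).codRestrict _ (C.branch_mem h j))

lemma hasTaylor_nodeTaylor (h : N) (j : Fin 2) (f : C.nodeRing h) :
    HasTaylor (C.node j h) (f.1 j) (C.nodeTaylor h j f) :=
  hasTaylor_taylor ((C.branch h j).codRestrict _ (C.branch_mem h j) f)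

lemma coeff_zero_nodeTaylor {h : N} {f : C.nodeRing h} {c : ℂ}
    (hc : ∀ j, ∃ ρ ∈ localRing (C.node j h), f.1 j = algebraMap ℂ K c + param (C.node j h) * ρ)
    (j : Fin 2) : PowerSeries.coeff 0 (C.nodeTaylor h j f) = c := by
  obtain ⟨ρ, hρ, e⟩ := hc j
  obtain ⟨R, hR⟩ := exists_hasTaylor hρ
  have h1 := C.hasTaylor_nodeTaylor h j f
  rw [e] at h1
  rw [h1.unique ((HasTaylor.const c).add (HasTaylor.param.mul hR))]
  simp

lemma coeff_zero_nodeTaylor_eq (h : N) (j : Fin 2) (f : C.nodeRing h) :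
    PowerSeries.coeff 0 (C.nodeTaylor h j f) = PowerSeries.coeff 0 (C.nodeTaylor h 0 f) := by
  obtain ⟨c, hc⟩ := f.2
  rw [C.coeff_zero_nodeTaylor hc, C.coeff_zero_nodeTaylor hc]

/-- The `m`-th Taylor coefficient on the `j`-th branch at the node `h` of a section of `ω_C ⊗ A`. -/
def jet (c : N → ℂˣ) (h : N) (j : Fin 2) (m : ℕ) : C.prymForms c →ₗ[ℂ] ℂ :=
  PowerSeries.coeff m ∘ₗ (C.nodeTaylor h j).toLinearMap ∘ₗ C.nodeCoeff c h

lemma jet_apply (c : N → ℂˣ) (h : N) (j : Fin 2) (m : ℕ) (σ : C.prymForms c) :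
    C.jet c h j m σ = PowerSeries.coeff m (C.nodeTaylor h j (C.nodeCoeff c h σ)) := rfl

variable {C} {c : N → ℂˣ} {h : N} {x : ⋀[ℂ]^2 (C.prymForms c)}

/-- The bilinear form `(f, g) ↦ coefficient of u ^ m in f dg / du`. -/
def derivForm {S : Type} [CommRing S] [Algebra ℂ S] (φ : S →ₐ[ℂ] PowerSeries ℂ) (m : ℕ) :
    S →ₗ[ℂ] S →ₗ[ℂ] ℂ :=
  LinearMap.mk₂ ℂ (fun f g => PowerSeries.coeff m (φ f * PowerSeries.derivative ℂ (φ g)))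
    (fun f f' g => by rw [map_add, add_mul, map_add])
    (fun z f g => by rw [map_smul, smul_mul_assoc, map_smul])
    (fun f g g' => by rw [map_add, map_add, mul_add, map_add])
    (fun z f g => by rw [map_smul, Derivation.map_smul, mul_smul_comm, map_smul])

lemma derivForm_mul {S : Type} [CommRing S] [Algebra ℂ S] (φ : S →ₐ[ℂ] PowerSeries ℂ) (m : ℕ)
    (f g h : S) : derivForm φ m f (g * h) = derivForm φ m (f * g) h + derivForm φ m (f * h) g := by
  simp only [derivForm, LinearMap.mk₂_apply, map_mul, Derivation.leibniz, smul_eq_mul]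
  rw [← map_add]
  congr 1
  ring

/-- The constant term of (f₁ f₂' - f₂ f₁') is a₀ b₁ - b₀ a₁. Gluing makes the constant terms equal
on both branches, so the zeroth jet can be taken on branch 0 for either j. -/
lemma wedge_jet_zero_one (hx : localGaussian (C.nodeCoeff c h) x = 0) (j : Fin 2) :
    wedge (C.jet c h 0 0) (C.jet c h j 1) x = 0 := by
  refine wedge_eq_zero_of_localGaussian _ (derivForm (C.nodeTaylor h j) 0)
    (derivForm_mul _ _) _ _ one_ne_zero (fun σ τ => ?_) hx
  simp only [jet_apply, ← coeff_zero_nodeTaylor_eq C h j, derivForm, LinearMap.mk₂_apply]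
  generalize C.nodeTaylor h j (C.nodeCoeff c h σ) = F
  generalize C.nodeTaylor h j (C.nodeCoeff c h τ) = G
  simp [PowerSeries.coeff_mul, PowerSeries.coeff_derivative]
  ring

/-- In the coefficient of u the products a₁ b₁ cancel, leaving 2 (a₀ b₂ - b₀ a₂). -/
lemma wedge_jet_zero_two (hx : localGaussian (C.nodeCoeff c h) x = 0) (j : Fin 2) :
    wedge (C.jet c h 0 0) (C.jet c h j 2) x = 0 := by
  refine wedge_eq_zero_of_localGaussian _ (derivForm (C.nodeTaylor h j) 1)
    (derivForm_mul _ _) _ _ two_ne_zero (fun σ τ => ?_) hx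
  simp only [jet_apply, ← coeff_zero_nodeTaylor_eq C h j, derivForm, LinearMap.mk₂_apply]
  generalize C.nodeTaylor h j (C.nodeCoeff c h σ) = F
  generalize C.nodeTaylor h j (C.nodeCoeff c h τ) = G
  simp [PowerSeries.coeff_mul, PowerSeries.coeff_derivative, Finset.Nat.antidiagonal_succ]
  ring

/-- The condition from the torsion of the differentials at the node. -/
lemma wedge_jet_one_one (hx : localGaussian (C.nodeCoeff c h) x = 0) :
    wedge (C.jet c h 0 1) (C.jet c h 1 1) x = 0 := by
  -- The linear coefficients q₀, q₁ are derivations at the node. The product q₀(f) q₁(g) alone does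
  -- not define a form on f dg; its antisymmetrization does. With x, y the branch parameters it
  -- takes x dy to 1 and y dx to -1, in accordance with d(xy) = 0.
  let q : Fin 2 → C.nodeRing h →ₗ[ℂ] ℂ := fun j =>
    PowerSeries.coeff 1 ∘ₗ (C.nodeTaylor h j).toLinearMap
  have hq : ∀ j f g, q j (f * g) = PowerSeries.coeff 0 (C.nodeTaylor h 0 f) * q j g +
      PowerSeries.coeff 0 (C.nodeTaylor h 0 g) * q j f := by
    intro j f g
    simp only [← coeff_zero_nodeTaylor_eq C h j, q, LinearMap.comp_apply, AlgHom.toLinearMap_apply,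
      map_mul]
    simp [PowerSeries.coeff_mul, Finset.Nat.antidiagonal_succ]
    ring
  refine wedge_eq_zero_of_localGaussian _
    (LinearMap.mk₂ ℂ (fun f g => q 0 f * q 1 g - q 1 f * q 0 g) ?_ ?_ ?_ ?_) ?_ _ _ two_ne_zero
    (fun σ τ => ?_) hx
  · intro f f' g; simp only [map_add]; ring
  · intro z f g; simp only [map_smul, smul_eq_mul]; ring
  · intro f g g'; simp only [map_add]; ring
  · intro z f g; simp only [map_smul, smul_eq_mul]; ring
  · intro f g g'
    simp only [LinearMap.mk₂_apply, hq]
    ring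
  · have e : ∀ j σ, q j (C.nodeCoeff c h σ) = C.jet c h j 1 σ := fun _ _ => rfl
    simp only [LinearMap.mk₂_apply, e]
    ring

/-- The zeroth jet is the residue, up to sign. -/
lemma regularFormAt_sub_jet (σ : C.prymForms c) (h : N) (j : Fin 2) :
    RegularFormAt (C.node j h)
      (σ.1 j - algebraMap ℂ K (C.jet c h 0 0 σ) * C.nodeGen c h j) := by
  obtain ⟨r, hr⟩ := σ.2.2 h
  have hjet : C.jet c h 0 0 σ = r := by
    rw [jet_apply]
    refine C.coeff_zero_nodeTaylor (fun j => ?_) 0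
    obtain ⟨ρ, hρ, e⟩ := hr j
    refine ⟨algebraMap ℂ K (![(c h : ℂ), -1] j)⁻¹ * ρ, mul_mem (algebraMap_mem _ _) hρ, ?_⟩
    rw [sub_eq_iff_eq_add] at e
    have h1 := sign_ne_zero c h j
    have h2 := dparam_ne_zero (C.node j h)
    have h3 := param_ne_zero (C.node j h)
    change σ.1 j / C.nodeGen c h j = _
    rw [e, add_div, mul_div_cancel_right₀ _ (C.nodeGen_ne_zero c h j), add_comm, nodeGen, map_inv₀]
    congr 1
    field_simp
  rw [hjet]
  exact hr j

lemma hasTaylor_jet (σ : C.prymForms c) (h : N) (j : Fin 2) :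
    ∃ F, HasTaylor (C.node j h) (σ.1 j / C.nodeGen c h j) F ∧
      ∀ m, C.jet c h j m σ = PowerSeries.coeff m F :=
  ⟨_, C.hasTaylor_nodeTaylor h j (C.nodeCoeff c h σ), fun _ => rfl⟩

end BinaryCurve

/-! ### Rational functions with simple poles -/

section SimplePoles

lemma hasTaylor_X_sub_C (a b : ℂ) :
    HasTaylor (b : P1) (RatFunc.X - RatFunc.C a) (PowerSeries.X + PowerSeries.C (b - a)) := by
  have h := (HasTaylor.param (p := (b : P1))).add (HasTaylor.const (b - a))
  have e : param (b : P1) + algebraMap ℂ K (b - a) = RatFunc.X - RatFunc.C a := by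
    change (RatFunc.X - RatFunc.C b) + RatFunc.C (b - a) = _
    rw [map_sub]
    ring
  rwa [e] at h

lemma hasTaylor_X_sub_C_inv {a b : ℂ} (hab : b ≠ a) :
    HasTaylor (b : P1) (RatFunc.X - RatFunc.C a)⁻¹ (PowerSeries.X + PowerSeries.C (b - a))⁻¹ := by
  refine (hasTaylor_X_sub_C a b).inv ?_
  simpa [sub_eq_zero] using hab

lemma hasTaylor_infty_X_mul_inv (a : ℂ) :
    HasTaylor OnePoint.infty (RatFunc.X * (RatFunc.X - RatFunc.C a)⁻¹)
      (1 - PowerSeries.C a * PowerSeries.X)⁻¹ := by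
  have h := ((HasTaylor.one (p := OnePoint.infty)).sub
    ((HasTaylor.const a).mul HasTaylor.param)).inv (by simp)
  have hX : (RatFunc.X : K) ≠ 0 := RatFunc.X_ne_zero
  have e : (1 - algebraMap ℂ K a * param OnePoint.infty)⁻¹ =
      RatFunc.X * (RatFunc.X - RatFunc.C a)⁻¹ := by
    change (1 - RatFunc.C a * RatFunc.X⁻¹)⁻¹ = _
    rw [show (1 - RatFunc.C a * RatFunc.X⁻¹ : K) = (RatFunc.X - RatFunc.C a) * RatFunc.X⁻¹ by
      rw [sub_mul, mul_inv_cancel₀ hX], mul_inv, inv_inv, mul_comm]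
  rwa [e] at h

/-- The partial fraction expansion of a rational function with at most simple poles in `ℂ` that
vanishes at `∞`. -/
lemma eq_sum_simplePoles {ι : Type*} [Fintype ι] (a : ι → ℂ) (ha : Function.Injective a) {f : K}
    {F : PowerSeries ℂ} (z : ι → ℂ) (h1 : ∀ b ∉ Set.range a, f ∈ localRing (b : P1))
    (h2 : ∀ i, f - algebraMap ℂ K (z i) * (RatFunc.X - RatFunc.C (a i))⁻¹ ∈
      localRing ((a i : ℂ) : P1))
    (h3 : HasTaylor OnePoint.infty (RatFunc.X * f) F) :
    f = ∑ i, algebraMap ℂ K (z i) * (RatFunc.X - RatFunc.C (a i))⁻¹ ∧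
      PowerSeries.coeff 0 F = ∑ i, z i := by
  classical
  have hpole : ∀ i b, b ≠ a i →
      algebraMap ℂ K (z i) * (RatFunc.X - RatFunc.C (a i))⁻¹ ∈ localRing (b : P1) :=
    fun i b hb => mul_mem (algebraMap_mem _ _) (hasTaylor_X_sub_C_inv hb).mem
  set g := ∑ i, algebraMap ℂ K (z i) * (RatFunc.X - RatFunc.C (a i))⁻¹ with hg
  have hreg : ∀ b : ℂ, f - g ∈ localRing (b : P1) := by
    intro b
    by_cases hb : b ∈ Set.range a
    · obtain ⟨i, rfl⟩ := hb
      rw [hg, ← Finset.add_sum_erase _ _ (Finset.mem_univ i), ← sub_sub]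
      refine sub_mem (h2 i) (sum_mem fun i' hi' => hpole i' _ fun e => ?_)
      exact (Finset.ne_of_mem_erase hi') (ha e).symm
    · exact sub_mem (h1 b hb) (sum_mem fun i _ => hpole i b fun e => hb ⟨i, e.symm⟩)
  have hinf : HasTaylor OnePoint.infty (RatFunc.X * g)
      (∑ i, PowerSeries.C (z i) * (1 - PowerSeries.C (a i) * PowerSeries.X)⁻¹) := by
    rw [hg, Finset.mul_sum]
    refine HasTaylor.sum _ _ _ fun i _ => ?_
    rw [mul_left_comm]
    exact (HasTaylor.const _).mul (hasTaylor_infty_X_mul_inv _)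
  -- The difference f - g has no finite pole, so it is a polynomial; it vanishes at ∞, so it is
  -- zero. Comparing constant terms at ∞ then gives the residue theorem.
  obtain ⟨P, hP⟩ := exists_polynomial_of_mem_localRing hreg
  have h4 := h3.sub hinf
  rw [← mul_sub, hP] at h4
  have hfg : f = g := by
    rw [eq_zero_of_hasTaylor_infty h4, map_zero] at hP
    exact sub_eq_zero.mp hP
  refine ⟨hfg, ?_⟩
  rw [← hfg] at hinf
  rw [h3.unique hinf, map_sum]
  simp [PowerSeries.constantCoeff_inv]

/-- No condition on d is needed: at d = 0 both inverses are 0 by convention. -/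
lemma coeff_one_X_mul_inv (d : ℂ) :
    PowerSeries.coeff 1 (PowerSeries.X * (PowerSeries.X + PowerSeries.C d)⁻¹) = d⁻¹ := by
  rw [show (1 : ℕ) = 0 + 1 from rfl, PowerSeries.coeff_succ_X_mul]
  simp [PowerSeries.constantCoeff_inv]

lemma coeff_two_X_mul_inv {d : ℂ} (hd : d ≠ 0) :
    PowerSeries.coeff 2 (PowerSeries.X * (PowerSeries.X + PowerSeries.C d)⁻¹) = -(d⁻¹) ^ 2 := by
  rw [show (2 : ℕ) = 1 + 1 from rfl, PowerSeries.coeff_succ_X_mul]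
  have h := congrArg (PowerSeries.coeff 1)
    (PowerSeries.mul_inv_cancel (PowerSeries.X + PowerSeries.C d) (by simpa using hd))
  rw [add_mul, map_add, show (1 : ℕ) = 0 + 1 from rfl, PowerSeries.coeff_succ_X_mul,
    PowerSeries.coeff_C_mul] at h
  simp [PowerSeries.constantCoeff_inv, PowerSeries.coeff_one] at h
  generalize PowerSeries.coeff 1 (PowerSeries.X + PowerSeries.C d)⁻¹ = z at h ⊢
  linear_combination d⁻¹ * h - z * mul_inv_cancel₀ hd

lemma coeff_one_inv_one_sub (d : ℂ) :
    PowerSeries.coeff 1 (1 - PowerSeries.C d * PowerSeries.X)⁻¹ = d := by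
  have h := congrArg (PowerSeries.coeff 1)
    (PowerSeries.mul_inv_cancel (1 - PowerSeries.C d * PowerSeries.X) (by simp))
  rw [sub_mul, one_mul, mul_assoc, map_sub, PowerSeries.coeff_C_mul, show (1 : ℕ) = 0 + 1 from rfl,
    PowerSeries.coeff_succ_X_mul] at h
  simp [PowerSeries.constantCoeff_inv, PowerSeries.coeff_one] at h
  linear_combination h

end SimplePoles

/-! ### Sections and the Gaussian map on Prym-canonical binary curves -/

section PrymCurve

open BinaryCurve

variable {g : ℕ} {a : Fin 2 × Fin (g - 1) → ℂ}

/-- The residues of a section at the nodes different from `0` and `∞`, up to sign. -/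
def residue (ha : Admissible a) (i : Fin (g - 1)) :
    (prymCurve a ha).prymForms (prymBundle g) →ₗ[ℂ] ℂ :=
  (prymCurve a ha).jet (prymBundle g) (NodeIndex.affine i) 0 0

/-- The sign of the residue on the `j`-th component at a node. -/
def nodeSign (g : ℕ) (j : Fin 2) (h : NodeIndex g) : ℂ :=
  ![(prymBundle g h : ℂ), -1] j

lemma nodeSign_ne_zero (j : Fin 2) (h : NodeIndex g) : nodeSign g j h ≠ 0 := by
  fin_cases j <;> simp [nodeSign]

lemma nodeSign_affine (j : Fin 2) (i : Fin (g - 1)) :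
    nodeSign g j (NodeIndex.affine i) = ![1, -1] j * compSign ℂ (g / 2) j i := by
  fin_cases j
  · simp only [nodeSign, compSign, prymBundle, Fin.zero_eta, Matrix.cons_val_zero, one_mul, if_true]
    split_ifs <;> simp
  · simp [nodeSign, compSign]

/-- The rational function `1 / (t - a) - ε / t` that describes a section with one residue, where
`ε = 0` for the first `k` nodes and `ε = 1` for the others. -/
def basicForm (a : Fin 2 × Fin (g - 1) → ℂ) (j : Fin 2) (i : Fin (g - 1)) : K :=
  (RatFunc.X - RatFunc.C (a (j, i)))⁻¹ - if i.val < g / 2 then 0 else RatFunc.X⁻¹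

lemma Admissible.ne_zero (ha : Admissible a) (j : Fin 2) (i : Fin (g - 1)) : a (j, i) ≠ 0 := by
  intro h
  have : NodeIndex.affine i = NodeIndex.zero := ha j (by rw [nodePos, nodePos, h])
  cases this

lemma Admissible.sub_ne_zero (ha : Admissible a) (j : Fin 2) {h i : Fin (g - 1)} (hi : i ≠ h) :
    a (j, h) - a (j, i) ≠ 0 := by
  intro e
  have : (NodeIndex.affine h : NodeIndex g) = NodeIndex.affine i :=
    ha j (by rw [nodePos, nodePos, sub_eq_zero.mp e])
  exact hi (NodeIndex.affine.inj this).symm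

lemma admissible_of_separated (ha : Separated a) : Admissible a := by
  intro j h h' e
  have h0 : ∀ i, a (j, i) ≠ 0 := fun i => ((ha j).1 i).ne_zero
  rcases h with i | _ | _ <;> rcases h' with i' | _ | _ <;>
    simp only [nodePos, OnePoint.coe_eq_coe, OnePoint.coe_ne_infty, OnePoint.infty_ne_coe] at e
  · congr 1
    by_contra hi
    exact ((ha j).2 i i' hi).ne_zero (sub_eq_zero.mpr e)
  · exact absurd e (h0 i)
  · exact absurd e.symm (h0 i')
  · rfl
  · rfl

/-- Every section is determined by its residues at the nodes different from `0` and `∞`. -/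
lemma prymForm_eq_sum (ha : Admissible a) (σ : (prymCurve a ha).prymForms (prymBundle g))
    (j : Fin 2) :
    σ.1 j = ∑ i, algebraMap ℂ K (residue ha i σ * nodeSign g j (NodeIndex.affine i)) *
      basicForm a j i := by
  let C := prymCurve a ha
  let r : NodeIndex g → ℂ := fun h => C.jet (prymBundle g) h 0 0 σ
  have hreg : ∀ h j, RegularFormAt (C.node j h)
      (σ.1 j - algebraMap ℂ K (r h) * C.nodeGen (prymBundle g) h j) :=
    fun h j => regularFormAt_sub_jet σ h j
  have hfin : ∀ (b : ℂ) (f : K), RegularFormAt (b : P1) f → f ∈ localRing (b : P1) := by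
    rintro b f ⟨ρ, hρ, rfl⟩
    exact mul_mem hρ (one_mem _)
  -- The possible finite poles are the affine nodes and 0, the latter indexed by `none`.
  let pos : Fin 2 → Option (Fin (g - 1)) → ℂ := fun j o => o.elim 0 fun i => a (j, i)
  let idx : Option (Fin (g - 1)) → NodeIndex g := fun o => o.elim NodeIndex.zero NodeIndex.affine
  have hpos : ∀ j o, C.node j (idx o) = (pos j o : P1) := by
    rintro j (_ | i) <;> rfl
  have hidx : Function.Injective idx := by
    rintro (_ | i) (_ | i') e
    · rfl
    · cases e
    · cases e
    · rw [NodeIndex.affine.inj e]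
  -- The partial fraction expansion on each component, together with the residue theorem there.
  have key : ∀ j, σ.1 j = ∑ o, algebraMap ℂ K (r (idx o) * nodeSign g j (idx o)) *
        (RatFunc.X - RatFunc.C (pos j o))⁻¹ ∧
      -(r NodeIndex.infty * nodeSign g j NodeIndex.infty) =
        ∑ o, r (idx o) * nodeSign g j (idx o) := by
    intro j
    obtain ⟨ρ, hρ, e⟩ := hreg NodeIndex.infty j
    obtain ⟨R, hR⟩ := exists_hasTaylor hρ
    have hX : (RatFunc.X : K) ≠ 0 := RatFunc.X_ne_zero
    -- Since du/u = -dt/t at ∞, the product of t with σ has value minus the signed residue there.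
    have hinf : HasTaylor OnePoint.infty (RatFunc.X * σ.1 j)
        (0 - PowerSeries.C (r NodeIndex.infty * nodeSign g j NodeIndex.infty) -
          R * PowerSeries.X) := by
      have h1 := ((HasTaylor.zero (p := OnePoint.infty)).sub (HasTaylor.const
        (r NodeIndex.infty * nodeSign g j NodeIndex.infty))).sub (hR.mul HasTaylor.param)
      convert h1 using 1
      rw [sub_eq_iff_eq_add] at e
      rw [e]
      change RatFunc.X * (ρ * (-(RatFunc.X⁻¹ ^ 2)) + algebraMap ℂ K (r NodeIndex.infty) *
        (algebraMap ℂ K (nodeSign g j NodeIndex.infty) * (-(RatFunc.X⁻¹ ^ 2) / RatFunc.X⁻¹))) =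
        0 - algebraMap ℂ K (r NodeIndex.infty * nodeSign g j NodeIndex.infty) - ρ * RatFunc.X⁻¹
      rw [map_mul]
      field_simp
      ring
    have h2 := eq_sum_simplePoles (pos j) ?_
      (fun o => r (idx o) * nodeSign g j (idx o)) (f := σ.1 j) ?_ ?_ hinf
    · refine ⟨h2.1, ?_⟩
      rw [← h2.2]
      simp
    · intro o o' e
      apply hidx
      apply C.node_injective j
      rw [hpos, hpos, e]
    · intro b hb
      refine hfin b _ (σ.2.1 j ⟨(b : P1), ?_⟩)
      rintro ⟨h, hh⟩
      rcases h with i | _ | _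
      · exact hb ⟨some i, OnePoint.coe_injective hh⟩
      · exact hb ⟨none, OnePoint.coe_injective hh⟩
      · exact OnePoint.infty_ne_coe b hh
    · intro o
      have h3 := hreg (idx o) j
      rw [hpos] at h3
      have h4 := hfin _ _ h3
      have e1 : C.nodeGen (prymBundle g) (idx o) j =
          algebraMap ℂ K (nodeSign g j (idx o)) * (RatFunc.X - RatFunc.C (pos j o))⁻¹ := by
        rw [nodeGen, hpos, div_eq_mul_inv]
        change _ * (1 * _) = _
        rw [one_mul]
        rfl
      rwa [e1, ← mul_assoc, ← map_mul] at h4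
  have hr : ∀ i, r (NodeIndex.affine i) = residue ha i σ := fun _ => rfl
  -- the residue at `0`
  have hzero : r NodeIndex.zero * nodeSign g j NodeIndex.zero = -∑ i : Fin (g - 1),
      if i.val < g / 2 then 0 else residue ha i σ * nodeSign g j (NodeIndex.affine i) := by
    have e0 := (key 0).2
    have e1 := (key 1).2
    rw [Fintype.sum_option] at e0 e1
    simp only [idx, Option.elim_none, Option.elim_some, hr] at e0 e1
    have s0 : nodeSign g 0 NodeIndex.zero = -1 := by simp [nodeSign, prymBundle]
    have s1 : nodeSign g 0 NodeIndex.infty = 1 := by simp [nodeSign, prymBundle]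
    have s2 : ∀ h, nodeSign g 1 h = -1 := fun h => by simp [nodeSign]
    -- Adding the residue theorems of the two components cancels the nodes with gluing factor 1,
    -- among them ∞, and doubles those with factor -1, among them 0.
    have s3 : ∑ i, residue ha i σ * nodeSign g 0 (NodeIndex.affine i) +
        ∑ i, residue ha i σ * nodeSign g 1 (NodeIndex.affine i) =
        2 * ∑ i : Fin (g - 1), if i.val < g / 2 then 0 else -residue ha i σ := by
      rw [← Finset.sum_add_distrib, Finset.mul_sum]
      refine Finset.sum_congr rfl fun i _ => ?_
      rw [nodeSign_affine, nodeSign_affine]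
      simp only [compSign]
      split_ifs <;> simp_all <;> ring
    have s4 : ∀ i : Fin (g - 1), (if i.val < g / 2 then 0 else
        residue ha i σ * nodeSign g j (NodeIndex.affine i)) =
        if i.val < g / 2 then 0 else -residue ha i σ := by
      intro i
      split_ifs with hi
      · rfl
      · fin_cases j <;> simp [nodeSign, prymBundle, hi]
    have s5 : nodeSign g j NodeIndex.zero = -1 := by
      fin_cases j <;> simp [nodeSign, prymBundle]
    simp only [s4, s5]
    rw [s0, s1] at e0
    rw [s2 NodeIndex.zero, s2 NodeIndex.infty] at e1
    linear_combination (-1 / 2 : ℂ) * e0 - (1 / 2 : ℂ) * e1 - (1 / 2 : ℂ) * s3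
  rw [(key j).1, Fintype.sum_option]
  simp only [idx, pos, Option.elim_none, Option.elim_some, hr, hzero]
  rw [map_neg, map_sum, neg_mul, Finset.sum_mul, neg_add_eq_sub, ← Finset.sum_sub_distrib]
  refine Finset.sum_congr rfl fun i _ => ?_
  rw [basicForm, mul_sub]
  congr 1
  split_ifs <;> simp

lemma eq_zero_of_residue_eq_zero (ha : Admissible a)
    (σ : (prymCurve a ha).prymForms (prymBundle g)) (hσ : ∀ i, residue ha i σ = 0) : σ = 0 := by
  refine Subtype.ext (funext fun j => ?_)
  rw [prymForm_eq_sum]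
  simp [hσ]

/-- The jets of a section at a node, in terms of the residues. -/
lemma jet_eq_sum (ha : Admissible a) (h : NodeIndex g) (j : Fin 2) (m : ℕ)
    (G : Fin (g - 1) → PowerSeries ℂ)
    (hG : ∀ i, HasTaylor (nodePos a j h)
      (param (nodePos a j h) / dparam (nodePos a j h) * basicForm a j i) (G i)) :
    (prymCurve a ha).jet (prymBundle g) h j m =
      ∑ i, ((nodeSign g j h)⁻¹ * ![1, -1] j * (compSign ℂ (g / 2) j i * PowerSeries.coeff m (G i))) •
        residue ha i := by
  ext σ
  obtain ⟨F, hF, hm⟩ := hasTaylor_jet σ h j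
  have h1 : HasTaylor (nodePos a j h) (σ.1 j / (prymCurve a ha).nodeGen (prymBundle g) h j)
      (∑ i, PowerSeries.C ((nodeSign g j h)⁻¹ * (residue ha i σ *
        nodeSign g j (NodeIndex.affine i))) * G i) := by
    have h2 := HasTaylor.sum Finset.univ _ _ fun i _ => (HasTaylor.const ((nodeSign g j h)⁻¹ *
      (residue ha i σ * nodeSign g j (NodeIndex.affine i)))).mul (hG i)
    convert h2 using 1
    rw [prymForm_eq_sum, Finset.sum_div]
    refine Finset.sum_congr rfl fun i _ => ?_
    change _ / (algebraMap ℂ K (nodeSign g j h) *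
      (dparam (nodePos a j h) / param (nodePos a j h))) = _
    have e1 : algebraMap ℂ K (nodeSign g j h) ≠ 0 := by
      rw [Ne, map_eq_zero]
      exact nodeSign_ne_zero j h
    have e2 := param_ne_zero (nodePos a j h)
    have e3 := dparam_ne_zero (nodePos a j h)
    rw [map_mul _ (nodeSign g j h)⁻¹, map_inv₀]
    field_simp
  rw [hm, hF.unique h1, map_sum, LinearMap.sum_apply]
  refine Finset.sum_congr rfl fun i _ => ?_
  rw [PowerSeries.coeff_C_mul, nodeSign_affine, LinearMap.smul_apply, smul_eq_mul]
  ring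

/-- Multiplied by u = t - a_h, a simple pole at distance d gives u / (u + d) = u/d - u²/d² + ⋯, and
the pole at the node itself gives the constant 1. The factor z does not depend on i and drops out of
the homogeneous equations. -/
lemma jet_affine (ha : Admissible a) (h : Fin (g - 1)) (j : Fin 2) :
    ∃ z : ℂ, z ≠ 0 ∧
      (prymCurve a ha).jet (prymBundle g) (NodeIndex.affine h) j 1 =
        ∑ i, (z * jetOne (g / 2) a j h i) • residue ha i ∧
      (prymCurve a ha).jet (prymBundle g) (NodeIndex.affine h) j 2 =
        ∑ i, (-z * jetTwo (g / 2) a j h i) • residue ha i := by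
  have hh := ha.ne_zero j h
  let P : ℂ → PowerSeries ℂ := fun d => PowerSeries.X * (PowerSeries.X + PowerSeries.C d)⁻¹
  let G : Fin (g - 1) → PowerSeries ℂ := fun i =>
    (if i = h then 1 else P (a (j, h) - a (j, i))) - if i.val < g / 2 then 0 else P (a (j, h))
  have hG : ∀ i, HasTaylor (a (j, h) : P1) (param (a (j, h) : P1) / dparam (a (j, h) : P1) *
      basicForm a j i) (G i) := by
    intro i
    change HasTaylor _ (param (a (j, h) : P1) / 1 * _) _
    rw [div_one, basicForm, mul_sub]
    refine HasTaylor.sub ?_ ?_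
    · split_ifs with hi
      · rw [hi]
        change HasTaylor _ (param (a (j, h) : P1) * (param (a (j, h) : P1))⁻¹) _
        rw [mul_inv_cancel₀ (param_ne_zero _)]
        exact HasTaylor.one
      · exact HasTaylor.param.mul (hasTaylor_X_sub_C_inv (sub_ne_zero.mp (ha.sub_ne_zero j hi)))
    · split_ifs with hi
      · rw [mul_zero]
        exact HasTaylor.zero
      · have := hasTaylor_X_sub_C_inv hh
        rw [map_zero, sub_zero, sub_zero] at this
        exact HasTaylor.param.mul this
  have hP1 : ∀ d, PowerSeries.coeff 1 (P d) = d⁻¹ := coeff_one_X_mul_inv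
  have hP2 : ∀ d, d ≠ 0 → PowerSeries.coeff 2 (P d) = -d⁻¹ ^ 2 := fun d hd => coeff_two_X_mul_inv hd
  refine ⟨(nodeSign g j (NodeIndex.affine h))⁻¹ * ![1, -1] j,
    mul_ne_zero (inv_ne_zero (nodeSign_ne_zero _ _)) (by fin_cases j <;> simp), ?_, ?_⟩
  · rw [jet_eq_sum ha (NodeIndex.affine h) j 1 G hG]
    refine Finset.sum_congr rfl fun i _ => ?_
    congr 3
    simp only [G, map_sub, Ring.inverse_eq_inv']
    congr 1
    · split_ifs
      · simp [PowerSeries.coeff_one]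
      · exact hP1 _
    · split_ifs
      · simp
      · exact hP1 _
  · rw [jet_eq_sum ha (NodeIndex.affine h) j 2 G hG]
    refine Finset.sum_congr rfl fun i _ => ?_
    rw [neg_mul, ← mul_neg, jetTwo, ← mul_neg]
    congr 3
    simp only [G, map_sub, Ring.inverse_eq_inv', neg_sub']
    congr 1
    · split_ifs with hi
      · simp [PowerSeries.coeff_one]
      · exact hP2 _ (ha.sub_ne_zero j hi)
    · split_ifs
      · simp
      · exact hP2 _ hh

/-- Here t / (t - a) has linear coefficient -1/a, and the pole at 0 contributes only a constant. -/
lemma jet_zero (ha : Admissible a) (j : Fin 2) :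
    ∃ z : ℂ, z ≠ 0 ∧ (prymCurve a ha).jet (prymBundle g) NodeIndex.zero j 1 =
      ∑ i, (z * (compSign ℂ (g / 2) j i * Ring.inverse (a (j, i)))) • residue ha i := by
  let G : Fin (g - 1) → PowerSeries ℂ := fun i =>
    PowerSeries.X * (PowerSeries.X + PowerSeries.C (0 - a (j, i)))⁻¹ -
      if i.val < g / 2 then 0 else 1
  have hX : param ((0 : ℂ) : P1) = RatFunc.X := by
    change RatFunc.X - RatFunc.C 0 = _
    rw [map_zero, sub_zero]
  have hG : ∀ i, HasTaylor ((0 : ℂ) : P1) (param ((0 : ℂ) : P1) / dparam ((0 : ℂ) : P1) *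
      basicForm a j i) (G i) := by
    intro i
    change HasTaylor _ (param ((0 : ℂ) : P1) / 1 * _) _
    rw [div_one, basicForm, mul_sub]
    refine (HasTaylor.param.mul (hasTaylor_X_sub_C_inv (ha.ne_zero j i).symm)).sub ?_
    split_ifs with hi
    · rw [mul_zero]
      exact HasTaylor.zero
    · rw [hX, mul_inv_cancel₀ RatFunc.X_ne_zero]
      exact HasTaylor.one
  refine ⟨-((nodeSign g j NodeIndex.zero)⁻¹ * ![1, -1] j),
    neg_ne_zero.mpr (mul_ne_zero (inv_ne_zero (nodeSign_ne_zero _ _)) (by fin_cases j <;> simp)), ?_⟩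
  rw [jet_eq_sum ha NodeIndex.zero j 1 G hG]
  refine Finset.sum_congr rfl fun i _ => ?_
  have e : PowerSeries.coeff 1 (G i) = -(a (j, i))⁻¹ := by
    change PowerSeries.coeff 1 (_ - _) = _
    rw [map_sub, coeff_one_X_mul_inv, zero_sub, inv_neg]
    split_ifs <;> simp [PowerSeries.coeff_one]
  rw [e, Ring.inverse_eq_inv']
  congr 1
  ring

/-- With u = 1/t, the relevant function is -t / (t - a) = -1 / (1 - a u), with linear coefficient
-a. -/
lemma jet_infty (ha : Admissible a) (j : Fin 2) :
    ∃ z : ℂ, z ≠ 0 ∧ (prymCurve a ha).jet (prymBundle g) NodeIndex.infty j 1 =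
      ∑ i, (z * (compSign ℂ (g / 2) j i * a (j, i))) • residue ha i := by
  have hX : (RatFunc.X : K) ≠ 0 := RatFunc.X_ne_zero
  let G : Fin (g - 1) → PowerSeries ℂ := fun i => PowerSeries.C (-1) *
    ((1 - PowerSeries.C (a (j, i)) * PowerSeries.X)⁻¹ - if i.val < g / 2 then 0 else 1)
  have hG : ∀ i, HasTaylor OnePoint.infty (param OnePoint.infty / dparam OnePoint.infty *
      basicForm a j i) (G i) := by
    intro i
    have e : param OnePoint.infty / dparam OnePoint.infty = algebraMap ℂ K (-1) * RatFunc.X := by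
      change RatFunc.X⁻¹ / (-(RatFunc.X⁻¹ ^ 2)) = _
      rw [map_neg, map_one]
      field_simp
    rw [e, mul_assoc, basicForm, mul_sub]
    refine (HasTaylor.const _).mul ((hasTaylor_infty_X_mul_inv _).sub ?_)
    split_ifs with hi
    · rw [mul_zero]
      exact HasTaylor.zero
    · rw [mul_inv_cancel₀ hX]
      exact HasTaylor.one
  refine ⟨-((nodeSign g j NodeIndex.infty)⁻¹ * ![1, -1] j),
    neg_ne_zero.mpr (mul_ne_zero (inv_ne_zero (nodeSign_ne_zero _ _)) (by fin_cases j <;> simp)), ?_⟩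
  rw [jet_eq_sum ha NodeIndex.infty j 1 G hG]
  refine Finset.sum_congr rfl fun i _ => ?_
  have e : PowerSeries.coeff 1 (G i) = -a (j, i) := by
    simp only [G, PowerSeries.coeff_C_mul, map_sub, coeff_one_inv_one_sub]
    split_ifs <;> simp [PowerSeries.coeff_one]
  rw [e]
  congr 1
  ring

/-- The Gaussian map is injective if the condition matrix is. -/
lemma gaussianMap_injective (ha : Admissible a)
    (hinj : ∀ x, (conditionMatrix (g / 2) a).mulVec x = 0 → x = 0) :
    Function.Injective ((prymCurve a ha).gaussianMap (prymBundle g)) := by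
  rw [injective_iff_map_eq_zero]
  intro x hx
  -- The vanishing takes place in the Kähler differentials of the node ring, torsion included; only
  -- the stalks at the nodes enter.
  have hloc : ∀ h, localGaussian ((prymCurve a ha).nodeCoeff (prymBundle g) h) x = 0 :=
    fun h => congrFun (congrArg Prod.fst (congrArg Subtype.val hx)) h
  -- An alternating form in the residues vanishes on x exactly when the corresponding row
  -- annihilates the coordinate vector of x; nonzero scalars y, z do not matter.
  have hcond : ∀ {y z : ℂ} {u v : Fin (g - 1) → ℂ}
      {U W : (prymCurve a ha).prymForms (prymBundle g) →ₗ[ℂ] ℂ}, y ≠ 0 → z ≠ 0 →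
      U = ∑ i, (y * u i) • residue ha i → W = ∑ i, (z * v i) • residue ha i → wedge U W x = 0 →
      ∑ q : Pair (g - 1), (u q.1.1 * v q.1.2 - u q.1.2 * v q.1.1) *
        wedge (residue ha q.1.1) (residue ha q.1.2) x = 0 := by
    rintro y z u v _ _ hy hz rfl rfl h
    rw [wedge_eq_sum] at h
    refine (mul_eq_zero.mp (Eq.trans ?_ h)).resolve_left (mul_ne_zero hy hz)
    rw [Finset.mul_sum]
    exact Finset.sum_congr rfl fun q _ => by ring
  have hres : ∀ h, residue ha h = ∑ i, (1 * Pi.single (M := fun _ => ℂ) h 1 i) • residue ha i := by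
    intro h
    simp [Pi.single_apply]
  refine eq_zero_of_wedge_eq_zero (residue ha) (eq_zero_of_residue_eq_zero ha) x
    (congrFun (hinj (fun q => wedge (residue ha q.1.1) (residue ha q.1.2) x) (funext fun c => ?_)))
  rcases c with ⟨h, s⟩ | s
  · obtain ⟨z, hz, h1, h2⟩ := jet_affine ha h 0
    obtain ⟨z', hz', h1', h2'⟩ := jet_affine ha h 1
    have hx := hloc (NodeIndex.affine h)
    fin_cases s
    · exact hcond one_ne_zero hz (hres h) h1 (wedge_jet_zero_one hx 0)
    · exact hcond one_ne_zero (neg_ne_zero.mpr hz) (hres h) h2 (wedge_jet_zero_two hx 0)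
    · exact hcond one_ne_zero hz' (hres h) h1' (wedge_jet_zero_one hx 1)
    · exact hcond one_ne_zero (neg_ne_zero.mpr hz') (hres h) h2' (wedge_jet_zero_two hx 1)
    · exact hcond hz hz' h1 h1' (wedge_jet_one_one hx)
  · fin_cases s
    · obtain ⟨z, hz, h1⟩ := jet_infty ha 0
      obtain ⟨z', hz', h1'⟩ := jet_infty ha 1
      exact hcond hz hz' h1 h1' (wedge_jet_one_one (hloc NodeIndex.infty))
    · obtain ⟨z, hz, h1⟩ := jet_zero ha 0
      obtain ⟨z', hz', h1'⟩ := jet_zero ha 1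
      exact hcond hz hz' h1 h1' (wedge_jet_one_one (hloc NodeIndex.zero))

end PrymCurve

end PrymBinary

end

theorem theorem5p1 (g : ℕ) (hg : 3 ≤ g) (hg' : g ≤ 12) :
    PrymBinary.ForGeneral fun a : Fin 2 × Fin (g - 1) → ℂ =>
      ∃ ha : PrymBinary.Admissible a,
        Function.Injective
          ((PrymBinary.prymCurve a ha).gaussianMap (PrymBinary.prymBundle g)) := by
  obtain ⟨F, hF, h⟩ := PrymBinary.exists_polynomial_conditionMatrix (n := g - 1) (by omega)
  rw [show (g - 1 + 1) / 2 = g / 2 by omega] at h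
  refine ⟨F, hF, fun a ha => ?_⟩
  obtain ⟨hsep, hinj⟩ := h a ha
  have hadm := PrymBinary.admissible_of_separated hsep
  exact ⟨hadm, PrymBinary.gaussianMap_injective hadm hinj⟩
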